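/- **Setting.** Let $d\in\mathbb N$, let $E$ be a finite set, and let $\Omega=E^{\mathbb Z^{d}\times\mathbb Z}$ with the product $\sigma$-algebra $\mathcal F$ and the product of the discrete topologies; write $\eta_t(x)$ for the value of $\eta\in\Omega$ at $(x,t)$. For $\Lambda\subset\mathbb Z^d\times\mathbb Z$ let $\mathcal F_\Lambda$ be the $\sigma$-algebra generated by the coordinates in $\Lambda$. Let $(\theta_{x,t}\eta)_s(y)=\eta_{s+t}(y+x)$. Let $\mathbb P$ be a probability measure on $\Omega$ that is invariant under all shifts $\theta_{x,t}$. It is called *ergodic in the time direction* if $\mathbb P(B)\in\{0,1\}$ for all $B\in\mathcal F$ with $\theta_{o,-1}^{-1}B=B$, where $o$ is the origin of $\mathbb Z^d$. Let $\alpha:\Omega\times\mathbb Z^d\to[0,1]$ with $\sum_z\alpha(\eta,z)=1$ for all $\eta$, and let $R\in\mathbb N$ be such that $\alpha(\eta,\cdot)$ depends on $\eta$ only through its values on $[-R,R]^d\times\{0\}$, and such that the jump range $\mathcal R=\{y:\sup_\eta\alpha(\eta,y)>0\}$ contains $o$ and satisfies $\|y\|_1\le R$ for all $y\in\mathcal R$.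 Given $\eta$, the walk $(X_t)_{t\ge0}$ has quenched law $P_\eta$ with $X_0=o$ and, given $X_0,\dots,X_t$ with $X_t=y$, $X_{t+1}=y+z$ with probability $\alpha(\theta_{y,t}\eta,z)$. For a probability measure $\mathbb Q$ on $\Omega$ let $P_{\mathbb Q}$ be the joint law of $(\eta,X)$, that is, $P_{\mathbb Q}(B\times A)=\int_B P_\eta(A)\,d\mathbb Q(\eta)$. The environment process is $\eta^{EP}_t=\theta_{X_t,t}\eta$. The walk is *elliptic in the time direction* if $\alpha(\eta,o)>0$ for all $\eta$. A probability measure $\mathbb Q$ on $\Omega$ is *invariant* under $(\eta^{EP}_t)$ if $P_{\mathbb Q}(\eta^{EP}_t\in\cdot)=\mathbb Q$ for all $t\ge 0$; it is *ergodic* with respect to $(\eta_t^{EP})$ if moreover $\mathbb Q(A)\in\{0,1\}$ for every $A\in\mathcal F$ such that $P_\eta(\eta_1^{EP}\in A)=\mathbf 1_A(\eta)$ for $\mathbb Q$-a.e. $\eta$. For $k\ge1$ let $\Gamma_k$ be the set of $(\gamma_{-k},\dots,\gamma_0)$ in $\mathbb Z^d$ with $\gamma_0=o$ and $\gamma_{i+1}-\gamma_i\in\mathcal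 R$ for $-k\le i<0$. For $\gamma\in\Gamma_k$, $\sigma\in\Omega$ let $$A_{-k}^{-1}(\gamma,\sigma)=\bigcap_{i=-k}^{-1}\{\eta:\ \eta_i(\gamma_i+y)=\sigma_i(y)\ \text{ for all } y\in[-R,R]^d\},$$ and let $\mathcal A_{-\infty}$ be the set of all such events, over all $k\ge1$, $\gamma\in\Gamma_k$, $\sigma\in\Omega$, that have positive $\mathbb P$-probability. Let $\mathcal C(j)=\{(x,t)\in\mathbb Z^d\times\mathbb Z_{\ge0}:\ \|x\|_1\le(R+1)t,\ t\ge j\}$ and $\mathcal F_\infty^\infty=\bigcap_{j\in\mathbb N}\mathcal F_{\mathcal C(j)}$. **Theorem.** Assume that $$\lim_{l\to\infty}\ \sup_{B\in\mathcal F_{\mathcal C(l)}}\ \sup_{A\in\mathcal A_{-\infty}}|\mathbb P(B\mid A)-\mathbb P(B)|=0 .$$ Then there is a probability measure $\mathbb P^{EP}$ on $\Omega$ that is invariant under $(\eta_t^{EP})$ and satisfies $\mathbb P^{EP}=\mathbb P$ on $\mathcal F_\infty^\infty$. If in addition $(X_t)$ is elliptic in the time direction and $\mathbb P$ is ergodic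 in the time direction, then $\mathbb P^{EP}$ is ergodic with respect to $(\eta_t^{EP})$, and for every probability measure $\mathbb Q$ on $\Omega$ with $\mathbb Q\ll\mathbb P$ on $\mathcal F^\infty_\infty$, $$\frac1t\sum_{s=0}^{t-1}P_{\mathbb Q}(\eta_s^{EP}\in\cdot)\ \text{ converges weakly to }\ \mathbb P^{EP}\quad\text{as } t\to\infty .$$ -/

import Mathlib

open MeasureTheory ProbabilityTheory Filter Topology
open scoped ENNReal BoundedContinuousFunction

noncomputable section

namespace RWRE

/-- Space-time points `(x, t)` with `x ∈ ℤ^d`, `t ∈ ℤ`. -/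
abbrev SpaceTime (d : ℕ) : Type := (Fin d → ℤ) × ℤ

/-- Environments `η : ℤ^{d+1} → E`, carrying the product `σ`-algebra. -/
abbrev Env (d : ℕ) (E : Type*) : Type _ := SpaceTime d → E

/-- The `ℓ¹`-norm on `ℤ^d`. -/
def normOne {d : ℕ} (x : Fin d → ℤ) : ℤ := ∑ i, |x i|

/-- The space-time shift `(θ_{x,t} η)_s(y) = η_{s+t}(y+x)`. -/
def shift {d : ℕ} {E : Type*} (x : Fin d → ℤ) (t : ℤ) (η : Env d E) : Env d E :=
  fun p => η (p.1 + x, p.2 + t)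

/-- The spatial box `[-R, R]^d`. -/
def box (d R : ℕ) : Set (Fin d → ℤ) := {y | ∀ i, |y i| ≤ (R : ℤ)}

/-- Transition probabilities `α(η, z)` of the walk, together with a range parameter `R`:
`α(η, ·)` is a probability on `ℤ^d`, it depends on `η` only through the values on
`[-R,R]^d × {0}`, and the jump range `{z : sup_η α(η, z) > 0}` contains the origin and is contained
in the `ℓ¹`-ball of radius `R` (in particular it is finite). -/
structure Walk (d : ℕ) (E : Type*) (R : ℕ) where
  /-- the jump distribution `α(η, ·)` -/
  prob : Env d E → PMF (Fin d → ℤ)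
  finite_range : ∀ η σ : Env d E, (∀ y ∈ box d R, η (y, 0) = σ (y, 0)) → prob η = prob σ
  zero_mem_jumps : 0 < ⨆ η, prob η 0
  jumps_bounded : ∀ z, 0 < ⨆ η, prob η z → normOne z ≤ R

section Model

variable {d : ℕ} {E : Type*} {R : ℕ}

/-- The jump range of the walk. -/
def Walk.jumps (W : Walk d E R) : Set (Fin d → ℤ) := {z | 0 < ⨆ η, W.prob η z}

/-- Ellipticity in the time direction. -/
def Walk.EllipticInTime (W : Walk d E R) : Prop := ∀ η, 0 < W.prob η 0

/-- For a fixed environment `η`: the law of `X_{n+1}` given the trajectory `X_0, …, X_n`, that is,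
`X_{n+1} = X_n + z` with probability `α(θ_{X_n,n} η, z)`. -/
def Walk.step (W : Walk d E R) (η : Env d E) (n : ℕ) :
    Kernel (Finset.Iic n → Fin d → ℤ) (Fin d → ℤ) :=
  Kernel.ofFunOfCountable fun h =>
    ((W.prob (shift (h ⟨n, Finset.mem_Iic.2 le_rfl⟩) n η)).map
      (fun z => h ⟨n, Finset.mem_Iic.2 le_rfl⟩ + z)).toMeasure

instance (W : Walk d E R) (η : Env d E) (n : ℕ) : IsMarkovKernel (W.step η n) :=
  ⟨fun _ => PMF.toMeasure.isProbabilityMeasure _⟩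

/-- The quenched law `P_η` of the walk started at the origin. -/
def Walk.quenchedLaw (W : Walk d E R) (η : Env d E) : Measure (ℕ → Fin d → ℤ) :=
  Kernel.traj (X := fun _ => Fin d → ℤ) (W.step η) 0 (fun _ => 0)

instance (W : Walk d E R) (η : Env d E) : IsProbabilityMeasure (W.quenchedLaw η) := by
  unfold Walk.quenchedLaw; infer_instance

variable [MeasurableSpace E]

lemma measurable_shift (x : Fin d → ℤ) (t : ℤ) : Measurable (shift (E := E) x t) :=
  measurable_pi_lambda _ fun p => measurable_pi_apply (p.1 + x, p.2 + t)

lemma finite_box (d R : ℕ) : (box d R).Finite := by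
  refine (Set.finite_Icc (fun _ : Fin d => -(R : ℤ)) (fun _ => (R : ℤ))).subset ?_
  intro y hy
  exact ⟨fun i => (abs_le.1 (hy i)).1, fun i => (abs_le.1 (hy i)).2⟩

lemma Walk.measurable_prob [Finite E] [MeasurableSingletonClass E] (W : Walk d E R)
    (z : Fin d → ℤ) : Measurable fun η => W.prob η z := by
  have : Finite (box d R) := finite_box d R
  have hdep : DependsOn (fun η => W.prob η z) ((fun y => ((y, 0) : SpaceTime d)) '' box d R) := by
    intro η σ h
    have := W.finite_range η σ fun y hy => h _ ⟨y, hy, rfl⟩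
    simp [this]
  obtain ⟨g, hg⟩ := dependsOn_iff_exists_comp.1 hdep
  rw [hg]
  have : Finite ((fun y => ((y, 0) : SpaceTime d)) '' box d R) :=
    ((finite_box d R).image _).to_subtype
  exact (measurable_of_countable g).comp (measurable_pi_lambda _ fun i => measurable_pi_apply _)

lemma Walk.measurable_step [Finite E] [MeasurableSingletonClass E] (W : Walk d E R) (n : ℕ)
    (h : Finset.Iic n → Fin d → ℤ) : Measurable fun η => W.step η n h := by
  refine Measure.measurable_of_measurable_coe _ fun s hs => ?_
  have : ∀ η, W.step η n h s = ∑' z, s.indicator 1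
      (h ⟨n, Finset.mem_Iic.2 le_rfl⟩ + z) *
        W.prob (shift (h ⟨n, Finset.mem_Iic.2 le_rfl⟩) n η) z := by
    intro η
    change ((W.prob (shift (h ⟨n, Finset.mem_Iic.2 le_rfl⟩) n η)).map
      (fun z => h ⟨n, Finset.mem_Iic.2 le_rfl⟩ + z)).toMeasure s = _
    rw [PMF.toMeasure_map_apply _ _ _ (measurable_of_countable _) hs,
      PMF.toMeasure_apply (hs := MeasurableSet.of_discrete)]
    refine tsum_congr fun z => ?_
    by_cases hz : h ⟨n, Finset.mem_Iic.2 le_rfl⟩ + z ∈ s <;> simp [Set.indicator, hz]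
  simp_rw [this]
  exact Measurable.tsum fun z =>
    ((W.measurable_prob z).comp (measurable_shift _ _)).const_mul _

lemma Walk.measurable_partialTraj [Finite E] [MeasurableSingletonClass E] (W : Walk d E R)
    (n : ℕ) : Measurable fun η =>
      Kernel.partialTraj (X := fun _ => Fin d → ℤ) (W.step η) 0 n (fun _ => 0) := by
  induction n with
  | zero => simp
  | succ n ih =>
    refine Measure.measurable_of_measurable_coe _ fun s hs => ?_
    have : ∀ η, Kernel.partialTraj (X := fun _ => Fin d → ℤ) (W.step η) 0 (n + 1) (fun _ => 0) s
        = ∑' h : Finset.Iic n → Fin d → ℤ, W.step η n h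
          {x | IicProdIoc (X := fun _ => Fin d → ℤ) n (n + 1)
            (h, MeasurableEquiv.piSingleton (X := fun _ => Fin d → ℤ) n x) ∈ s} *
          Kernel.partialTraj (X := fun _ => Fin d → ℤ) (W.step η) 0 n (fun _ => 0) {h} := by
      intro η
      have hm : Measurable (MeasurableEquiv.piSingleton (X := fun _ => Fin d → ℤ) n) :=
        MeasurableEquiv.measurable _
      have hi : Measurable (IicProdIoc (X := fun _ => Fin d → ℤ) n (n + 1)) :=
        measurable_IicProdIoc
      have := Kernel.IsMarkovKernel.map (W.step η n) hm
      rw [Kernel.partialTraj_succ_eq_comp (Nat.zero_le n), Kernel.comp_apply' _ _ _ hs,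
        lintegral_countable']
      refine tsum_congr fun h => ?_
      congr 1
      rw [Kernel.partialTraj_succ_self, Kernel.map_apply' _ hi _ hs,
        Kernel.id_prod_apply' _ _ (hi hs), Kernel.map_apply' _ hm]
      · rfl
      · exact measurable_prodMk_left (hi hs)
    simp_rw [this]
    refine Measurable.tsum fun h => Measurable.mul ?_ ?_
    · exact (Measure.measurable_coe (MeasurableSet.of_discrete)).comp (W.measurable_step n h)
    · exact (Measure.measurable_coe (measurableSet_singleton h)).comp ih

lemma Walk.measurable_quenchedLaw [Finite E] [MeasurableSingletonClass E] (W : Walk d E R) :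
    Measurable W.quenchedLaw := by
  refine Measurable.measure_of_isPiSystem_of_isProbabilityMeasure
    generateFrom_measurableCylinders.symm isPiSystem_measurableCylinders fun s hs => ?_
  obtain ⟨I, S, hS, rfl⟩ := (mem_measurableCylinders s).1 hs
  have hI : I ⊆ Finset.Iic (I.sup id) := fun i hi => Finset.mem_Iic.2 (Finset.le_sup (f := id) hi)
  have : ∀ η, W.quenchedLaw η (cylinder I S) =
      Kernel.partialTraj (X := fun _ => Fin d → ℤ) (W.step η) 0 (I.sup id) (fun _ => 0)
        (Finset.restrict₂ (π := fun _ => Fin d → ℤ) hI ⁻¹' S) := by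
    intro η
    have hm : Measurable (Finset.restrict₂ (π := fun _ => Fin d → ℤ) hI) :=
      Finset.measurable_restrict₂ hI
    rw [← Kernel.traj_map_frestrictLe_apply,
      Measure.map_apply (Preorder.measurable_frestrictLe _) (hm hS)]
    rfl
  simp_rw [this]
  have hm : Measurable (Finset.restrict₂ (π := fun _ => Fin d → ℤ) hI) :=
    Finset.measurable_restrict₂ hI
  exact (Measure.measurable_coe (hm hS)).comp (W.measurable_partialTraj (I.sup id))

/-- The environment process `η_t^EP = θ_{X_t,t} η`, as a function of `(η, X)`. -/
def envProcess (t : ℕ) (p : Env d E × (ℕ → Fin d → ℤ)) : Env d E := shift (p.2 t) t p.1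

lemma measurable_envProcess (t : ℕ) : Measurable (envProcess (d := d) (E := E) t) := by
  have h : Measurable fun q : (Fin d → ℤ) × Env d E => shift q.1 t q.2 :=
    measurable_from_prod_countable_right fun x => measurable_shift x t
  have h' : Measurable fun p : Env d E × (ℕ → Fin d → ℤ) => (p.2 t, p.1) := by fun_prop
  exact h.comp h'

variable [Finite E] [MeasurableSingletonClass E]

/-- The quenched law as a kernel from environments to walk trajectories. -/
def Walk.quenched (W : Walk d E R) : Kernel (Env d E) (ℕ → Fin d → ℤ) where
  toFun := W.quenchedLaw
  measurable' := W.measurable_quenchedLaw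

instance (W : Walk d E R) : IsMarkovKernel W.quenched :=
  ⟨fun η => inferInstanceAs (IsProbabilityMeasure (W.quenchedLaw η))⟩

/-- The joint law `P_Q` of environment and walk, `P_Q(B × A) = ∫_B P_η(A) dQ(η)`. -/
def Walk.jointLaw (W : Walk d E R) (Q : Measure (Env d E)) :
    Measure (Env d E × (ℕ → Fin d → ℤ)) :=
  Q ⊗ₘ W.quenched

/-- The law `P_Q(η_t^EP ∈ ·)`. -/
def Walk.envLaw (W : Walk d E R) (Q : Measure (Env d E)) (t : ℕ) : Measure (Env d E) :=
  (W.jointLaw Q).map (envProcess t)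

/-- The Cesàro average `t⁻¹ ∑_{s<t} P_Q(η_s^EP ∈ ·)`. -/
def Walk.cesaro (W : Walk d E R) (Q : Measure (Env d E)) (t : ℕ) : Measure (Env d E) :=
  (t : ℝ≥0∞)⁻¹ • ∑ s ∈ Finset.range t, W.envLaw Q s

/-- `Q` is invariant under the environment process. -/
def Walk.IsInvariant (W : Walk d E R) (Q : Measure (Env d E)) : Prop :=
  ∀ t, W.envLaw Q t = Q

/-- `Q` is ergodic with respect to the Markov process `(η_t^EP)`: it is invariant, and every event
`A` that is invariant under the evolution, `P_η(η_1^EP ∈ A) = 1_A(η)` for `Q`-a.e. `η`, is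
`Q`-trivial. -/
def Walk.IsErgodic (W : Walk d E R) (Q : Measure (Env d E)) : Prop :=
  W.IsInvariant Q ∧ ∀ A : Set (Env d E), MeasurableSet A →
    (∀ᵐ η ∂Q, W.quenched η {X | envProcess 1 (η, X) ∈ A} = A.indicator 1 η) →
      Q A = 0 ∨ Q A = 1

/-- Invariance of the environment law under all space-time translations. -/
def TranslationInvariant (P : Measure (Env d E)) : Prop :=
  ∀ (x : Fin d → ℤ) (t : ℤ), P.map (shift x t) = P

/-- Ergodicity of the environment law in the time direction: events invariant under the unit time
shift have probability `0` or `1`. -/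
def ErgodicInTime (P : Measure (Env d E)) : Prop :=
  ∀ B : Set (Env d E), MeasurableSet B → shift 0 (-1) ⁻¹' B = B → P B = 0 ∨ P B = 1

/-- `γ = (γ_{-k}, …, γ_0)` is a possible backward trajectory of length `k` from the origin (the
values of `γ` outside `[-k, 0]` are irrelevant). -/
def Walk.IsBackwardPath (W : Walk d E R) (k : ℕ) (γ : ℤ → Fin d → ℤ) : Prop :=
  γ 0 = 0 ∧ ∀ i : ℤ, -k ≤ i → i < 0 → γ (i + 1) - γ i ∈ W.jumps

/-- The event that, for `-k ≤ i ≤ -1`, the environment at time `i` in the `R`-box around `γ_i`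
shows the pattern `σ_i`. -/
def observation (R k : ℕ) (γ : ℤ → Fin d → ℤ) (σ : Env d E) : Set (Env d E) :=
  {η | ∀ i : ℤ, -k ≤ i → i ≤ -1 → ∀ y ∈ box d R, shift (γ i) i η (y, 0) = σ (y, i)}

/-- The set of all observations along backward paths that have positive probability. -/
def Walk.possibleObservations (W : Walk d E R) (P : Measure (Env d E)) : Set (Set (Env d E)) :=
  {A | ∃ k : ℕ, 1 ≤ k ∧ ∃ γ, W.IsBackwardPath k γ ∧ ∃ σ, A = observation R k γ σ ∧ 0 < P A}

/-- The far part `{(x, t) : t ≥ 0, t ≥ j, ‖x‖₁ ≤ (R+1) t}` of the forward cone. -/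
def cone (d R : ℕ) (j : ℤ) : Set (SpaceTime d) :=
  {p | 0 ≤ p.2 ∧ j ≤ p.2 ∧ normOne p.1 ≤ (R + 1) * p.2}

/-- The `σ`-algebra generated by the coordinates in `cone d R j`. -/
abbrev coneSigma (d : ℕ) (E : Type*) [MeasurableSpace E] (R : ℕ) (j : ℤ) : MeasurableSpace (Env d E) :=
  cylinderEvents (X := fun _ : SpaceTime d => E) (cone d R j)

/-- The tail `σ`-algebra of the forward cone. -/
abbrev coneTail (d : ℕ) (E : Type*) [MeasurableSpace E] (R : ℕ) : MeasurableSpace (Env d E) :=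
  ⨅ j : ℕ, coneSigma d E R j

/-- The weak cone-mixing condition: `sup_B sup_A |P(B | A) - P(B)| → 0` as `l → ∞`, where `B` ranges
over the events of the cone beyond time `l` and `A` over the possible observations. -/
def Walk.ConeMixing (W : Walk d E R) (P : Measure (Env d E)) : Prop :=
  Tendsto (fun l : ℕ => ⨆ (B : Set (Env d E)) (_ : MeasurableSet[coneSigma d E R l] B)
    (A : Set (Env d E)) (_ : A ∈ W.possibleObservations P),
      ENNReal.ofReal |(P[|A]).real B - P.real B|) atTop (𝓝 0)

end Model

end RWRE

end

/-! Write `T f(η) = ∑_z α(η,z) f(θ_{z,1} η)` for the transition operator of the environment process;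
under `P_Q` the law of `η_n^EP` integrates `f` to `∫ T^n f dQ`. The jump range is finite and `α` is
local, so `T` preserves local and continuous functions.

Existence. Expand `T^m` over the possible paths of the walk and recentre at the endpoint. The
product of jump probabilities along a path is a nonnegative function of what the walk has seen in
its past, so the environment seen from the walk is a mixture of laws `P(· | A)` with `A` an
observation along a backward path. Cone mixing therefore gives `|P_P(η_m^EP ∈ B) - P(B)| ≤ ε` for
events `B` far in the cone, uniformly in `m` (`abs_integral_mul_trans_iterate_le`). A weak limit `μ`
of the Cesàro averages is invariant, inherits the bound, and so agrees with `P` on the tail.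

Ergodicity. Ellipticity and compactness give `α(·,o) ≥ ε > 0`. Hence `μ`, though not shift
invariant, is nonsingular under forward time shifts: `ε^j μ(θ_{o,j}⁻¹ B) ≤ μ(B)`. An event `A` with
`T 1_A = 1_A` is time-shift invariant up to null sets. Approximate `A` by a local event and apply
`T^n`, an `L¹(μ)`-contraction that fixes `1_A`: seen from a late time, the result depends only on
the far cone. So `A` is almost surely a tail event (`exists_coneTail_ae_eq`), where `μ = P`, and
ergodicity of `P` in time makes it trivial.

Convergence. The mean ergodic theorem in `L²(μ)` gives, along subsequences, `μ`-a.e. convergence of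
the averages of `T^s f`. Convergence from all late points of the cone is a tail event, so it passes
from `μ` to `P` and on to `Q`; the walk then carries it back to the origin, because averages forget
finitely many initial steps. -/

noncomputable section

/-! ### Bounded measurable functions, shifts, and the transition operator of the environment
process. -/

namespace RWRE

/-- Bounded measurable real functions. -/
def BddMeasurable {Ω : Type*} [MeasurableSpace Ω] (f : Ω → ℝ) : Prop :=
  Measurable f ∧ ∃ C, ∀ x, |f x| ≤ C

section BddMeasurable

variable {Ω Ω' : Type*} [MeasurableSpace Ω] [MeasurableSpace Ω'] {f g : Ω → ℝ}

lemma BddMeasurable.integrable (hf : BddMeasurable f) (μ : Measure Ω) [IsFiniteMeasure μ] :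
    Integrable f μ := by
  obtain ⟨hm, C, hC⟩ := hf
  exact Integrable.of_bound hm.aestronglyMeasurable C (ae_of_all _ fun x => by simpa using hC x)

lemma BddMeasurable.comp (hf : BddMeasurable f) {φ : Ω' → Ω} (hφ : Measurable φ) :
    BddMeasurable fun x => f (φ x) :=
  ⟨hf.1.comp hφ, hf.2.imp fun _ h x => h (φ x)⟩

lemma BddMeasurable.mul (hf : BddMeasurable f) (hg : BddMeasurable g) :
    BddMeasurable fun x => f x * g x := by
  obtain ⟨hf, C, hC⟩ := hf
  obtain ⟨hg, D, hD⟩ := hg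
  refine ⟨hf.mul hg, C * D, fun x => ?_⟩
  rw [abs_mul]
  exact mul_le_mul (hC x) (hD x) (abs_nonneg _) ((abs_nonneg _).trans (hC x))

lemma BddMeasurable.add (hf : BddMeasurable f) (hg : BddMeasurable g) :
    BddMeasurable fun x => f x + g x := by
  obtain ⟨hf, C, hC⟩ := hf
  obtain ⟨hg, D, hD⟩ := hg
  exact ⟨hf.add hg, C + D, fun x => (abs_add_le _ _).trans (add_le_add (hC x) (hD x))⟩

lemma BddMeasurable.const (c : ℝ) : BddMeasurable fun _ : Ω => c :=
  ⟨measurable_const, |c|, fun _ => le_rfl⟩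

lemma BddMeasurable.sum {ι : Type*} (s : Finset ι) {F : ι → Ω → ℝ}
    (h : ∀ i ∈ s, BddMeasurable (F i)) : BddMeasurable fun x => ∑ i ∈ s, F i x := by
  classical
  induction s using Finset.induction_on with
  | empty => simpa using BddMeasurable.const 0
  | insert a s ha ih =>
    simp_rw [Finset.sum_insert ha]
    exact (h a (by simp)).add (ih fun i hi => h i (by simp [hi]))

lemma BddMeasurable.indicator {A : Set Ω} (hA : MeasurableSet A) :
    BddMeasurable (A.indicator (1 : Ω → ℝ)) := by
  refine ⟨measurable_one.indicator hA, 1, fun x => ?_⟩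
  by_cases h : x ∈ A <;> simp [h]

end BddMeasurable

variable {d : ℕ} {E : Type*} {R : ℕ}

lemma shift_shift (x y : Fin d → ℤ) (s t : ℤ) (η : Env d E) :
    shift y s (shift x t η) = shift (x + y) (t + s) η := by
  funext p
  simp only [shift]
  congr 2
  · abel
  · ring

@[simp] lemma shift_zero (η : Env d E) : shift 0 0 η = η := by
  funext p; simp [shift]

lemma finite_ball (d R : ℕ) : {z : Fin d → ℤ | normOne z ≤ R}.Finite := by
  refine (finite_box d R).subset fun z hz i => le_trans ?_ hz
  exact Finset.single_le_sum (f := fun i => |z i|) (fun _ _ => abs_nonneg _) (Finset.mem_univ i)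

/-- The `ℓ¹`-ball of radius `R` as a finite set. -/
def ball (d R : ℕ) : Finset (Fin d → ℤ) := (finite_ball d R).toFinset

lemma mem_ball {z : Fin d → ℤ} : z ∈ ball d R ↔ normOne z ≤ R := by simp [ball]

lemma normOne_add (x y : Fin d → ℤ) : normOne (x + y) ≤ normOne x + normOne y := by
  simp only [normOne, ← Finset.sum_add_distrib]
  exact Finset.sum_le_sum fun i _ => abs_add_le _ _

@[simp] lemma normOne_zero : normOne (0 : Fin d → ℤ) = 0 := by simp [normOne]

lemma normOne_le_of_mem_box {y : Fin d → ℤ} (hy : y ∈ box d R) : normOne y ≤ d * R := by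
  simpa [normOne] using Finset.sum_le_card_nsmul Finset.univ (fun i => |y i|) (R : ℤ)
    fun i _ => hy i

namespace Walk

variable (W : Walk d E R)

/-- The probability of the jump `z`, as a real number. -/
def weight (z : Fin d → ℤ) (η : Env d E) : ℝ := (W.prob η z).toReal

/-- The transition operator of the environment process. -/
def trans (f : Env d E → ℝ) (η : Env d E) : ℝ :=
  ∑ z ∈ ball d R, W.weight z η * f (shift z 1 η)

lemma weight_nonneg (z : Fin d → ℤ) (η : Env d E) : 0 ≤ W.weight z η := ENNReal.toReal_nonneg

lemma mem_jumps_of_prob_ne_zero {z : Fin d → ℤ} {η : Env d E} (h : W.prob η z ≠ 0) :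
    z ∈ W.jumps :=
  (pos_iff_ne_zero.2 h).trans_le (le_iSup (fun η => W.prob η z) η)

lemma mem_jumps_of_weight_ne_zero {z : Fin d → ℤ} {η : Env d E} (h : W.weight z η ≠ 0) :
    z ∈ W.jumps :=
  W.mem_jumps_of_prob_ne_zero (η := η) fun h' => h (by simp [weight, h'])

lemma weight_eq_zero {z : Fin d → ℤ} (hz : z ∉ ball d R) (η : Env d E) : W.weight z η = 0 := by
  by_contra h
  exact hz (mem_ball.2 (W.jumps_bounded z (W.mem_jumps_of_weight_ne_zero h)))

lemma sum_weight (η : Env d E) : ∑ z ∈ ball d R, W.weight z η = 1 := by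
  rw [← tsum_eq_sum (L := .unconditional _) (f := fun z => W.weight z η)
    fun z hz => W.weight_eq_zero hz η]
  have := (W.prob η).tsum_coe
  simp only [weight]
  rw [← ENNReal.tsum_toReal_eq fun z => (W.prob η).apply_ne_top z, this, ENNReal.toReal_one]

lemma trans_const (c : ℝ) : W.trans (fun _ => c) = fun _ => c := by
  funext η
  simp [trans, ← Finset.sum_mul, W.sum_weight]

lemma trans_sub (f g : Env d E → ℝ) : W.trans (fun η => f η - g η) =
    fun η => W.trans f η - W.trans g η := by
  funext η
  simp [trans, mul_sub, Finset.sum_sub_distrib]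

lemma trans_le {f g : Env d E → ℝ} (h : ∀ η, f η ≤ g η) (η : Env d E) :
    W.trans f η ≤ W.trans g η :=
  Finset.sum_le_sum fun _ _ => mul_le_mul_of_nonneg_left (h _) (W.weight_nonneg _ _)

lemma abs_trans_le {f : Env d E → ℝ} {C : ℝ} (h : ∀ η, |f η| ≤ C) (η : Env d E) :
    |W.trans f η| ≤ C := by
  have h1 := W.trans_le (fun η => (abs_le.1 (h η)).1) η
  have h2 := W.trans_le (fun η => (abs_le.1 (h η)).2) η
  rw [W.trans_const] at h1 h2
  exact abs_le.2 ⟨h1, h2⟩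

lemma abs_trans_iterate_le {f : Env d E → ℝ} {C : ℝ} (h : ∀ η, |f η| ≤ C) (n : ℕ)
    (η : Env d E) : |W.trans^[n] f η| ≤ C := by
  induction n generalizing η with
  | zero => exact h η
  | succ n ih =>
    rw [Function.iterate_succ_apply']
    exact W.abs_trans_le ih η

lemma trans_iterate_sub (f g : Env d E → ℝ) (n : ℕ) : W.trans^[n] (fun η => f η - g η) =
    fun η => W.trans^[n] f η - W.trans^[n] g η := by
  induction n with
  | zero => rfl
  | succ n ih => simp only [Function.iterate_succ_apply', ih, trans_sub]

lemma dependsOn_weight (z : Fin d → ℤ) :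
    DependsOn (W.weight z) {p : SpaceTime d | p.1 ∈ box d R ∧ p.2 = 0} := by
  intro η σ h
  simp only [weight]
  rw [W.finite_range η σ fun y hy => h _ ⟨hy, rfl⟩]

variable [MeasurableSpace E]

lemma integral_step (η : Env d E) (n : ℕ) (h : Finset.Iic n → Fin d → ℤ)
    {g : Env d E → ℝ} (hg : BddMeasurable g) :
    ∫ y, g (shift y ((n + 1 : ℕ) : ℤ) η) ∂(W.step η n h) =
      W.trans g (shift (h ⟨n, Finset.mem_Iic.2 le_rfl⟩) n η) := by
  set x := h ⟨n, Finset.mem_Iic.2 le_rfl⟩ with hx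
  obtain ⟨-, C, hC⟩ := hg
  change ∫ y, _ ∂((W.prob (shift x n η)).map (fun z => x + z)).toMeasure = _
  rw [← PMF.toMeasure_map _ _ (measurable_of_countable _),
    integral_map (measurable_of_countable _).aemeasurable
      (measurable_of_countable _).aestronglyMeasurable,
    PMF.integral_eq_tsum]
  · rw [trans, tsum_eq_sum (s := ball d R)]
    · refine Finset.sum_congr rfl fun z _ => ?_
      rw [shift_shift]
      simp [weight]
    · intro z hz
      have := W.weight_eq_zero hz (shift x n η)
      simp only [weight] at this
      simp [this]
  · exact Integrable.of_bound (measurable_of_countable _).aestronglyMeasurable C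
      (ae_of_all _ fun z => by simpa using hC _)

/-- This is the Markov property at time `n`: condition on the first `n` steps and integrate out the
next jump. Positions form a countable space, so functions of them are automatically measurable. -/
lemma integral_quenchedLaw_succ (η : Env d E) (n : ℕ) {g : Env d E → ℝ}
    (hg : BddMeasurable g) :
    ∫ X, g (shift (X (n + 1)) ((n + 1 : ℕ) : ℤ) η) ∂(W.quenchedLaw η) =
      ∫ X, W.trans g (shift (X n) n η) ∂(W.quenchedLaw η) := by
  obtain ⟨hm, C, hC⟩ := id hg
  have hmeas : ∀ (m : ℕ) (u : (Fin d → ℤ) → ℝ),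
      Measurable fun X : ℕ → Fin d → ℤ => u (X m) :=
    fun m u => (measurable_of_countable u).comp (measurable_pi_apply m)
  unfold quenchedLaw
  rw [← Kernel.integral_traj_partialTraj (X := fun _ => Fin d → ℤ) (κ := W.step η)
    (Nat.zero_le n) (Integrable.of_bound
      (hmeas (n + 1) fun y => g (shift y ((n + 1 : ℕ) : ℤ) η)).aestronglyMeasurable C
      (ae_of_all _ fun X => by simpa using hC _))]
  rw [← Kernel.traj_map_frestrictLe_apply, integral_map]
  · refine integral_congr_ae (ae_of_all _ fun X => ?_)
    have h := integral_map (μ := Kernel.traj (X := fun _ => Fin d → ℤ) (W.step η) n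
      (Preorder.frestrictLe n X)) (φ := fun X => X (n + 1))
      (f := fun y => g (shift y ((n + 1 : ℕ) : ℤ) η))
      (measurable_pi_apply _).aemeasurable (measurable_of_countable _).aestronglyMeasurable
    dsimp only
    rw [← h, ← Kernel.map_apply _ (measurable_pi_apply _), Kernel.map_traj_succ_self,
      W.integral_step η n _ hg]
    rfl
  · exact (Preorder.measurable_frestrictLe n).aemeasurable
  · exact (measurable_of_countable _).aestronglyMeasurable

variable [Finite E] [MeasurableSingletonClass E]

lemma bddMeasurable_weight (z : Fin d → ℤ) : BddMeasurable (W.weight z) := by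
  refine ⟨(W.measurable_prob z).ennreal_toReal, 1, fun η => ?_⟩
  rw [abs_of_nonneg (W.weight_nonneg z η)]
  exact ENNReal.toReal_le_of_le_ofReal zero_le_one (by simpa using (W.prob η).coe_le_one z)

lemma bddMeasurable_trans {f : Env d E → ℝ} (hf : BddMeasurable f) :
    BddMeasurable (W.trans f) :=
  BddMeasurable.sum _ fun z _ => (W.bddMeasurable_weight z).mul (hf.comp (measurable_shift z 1))

lemma bddMeasurable_trans_iterate {f : Env d E → ℝ} (hf : BddMeasurable f) (n : ℕ) :
    BddMeasurable (W.trans^[n] f) := by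
  induction n with
  | zero => exact hf
  | succ n ih =>
    rw [Function.iterate_succ_apply']
    exact W.bddMeasurable_trans ih

/-- The law of the environment process is described by the iterates of the transition operator. -/
lemma integral_quenchedLaw (η : Env d E) (n : ℕ) {g : Env d E → ℝ} (hg : BddMeasurable g) :
    ∫ X, g (envProcess n (η, X)) ∂(W.quenchedLaw η) = W.trans^[n] g η := by
  induction n generalizing g with
  | zero =>
    -- The trajectory kernel keeps its initial history, so the time-zero marginal is a Dirac mass at
    -- the origin.
    have : ∀ᵐ X ∂(W.quenchedLaw η), X 0 = 0 := by
      have h : (W.quenchedLaw η).map (Preorder.frestrictLe 0) = Measure.dirac (fun _ => 0) := by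
        unfold quenchedLaw
        rw [Kernel.traj_map_frestrictLe_apply, Kernel.partialTraj_self, Kernel.id_apply]
      have h' : ∀ᵐ x ∂((W.quenchedLaw η).map (Preorder.frestrictLe (π := fun _ => Fin d → ℤ) 0)),
          x ⟨0, Finset.mem_Iic.2 le_rfl⟩ = 0 := by
        rw [h, ae_dirac_eq]
        rfl
      exact ae_of_ae_map (Preorder.measurable_frestrictLe 0).aemeasurable h'
    rw [integral_congr_ae (g := fun _ => g η)]
    · simp
    · filter_upwards [this] with X hX
      simp [envProcess, hX]
  | succ n ih =>
    rw [Function.iterate_succ_apply, ← ih (W.bddMeasurable_trans hg)]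
    exact W.integral_quenchedLaw_succ η n hg

lemma integral_envLaw (Q : Measure (Env d E)) [IsProbabilityMeasure Q] (n : ℕ)
    {g : Env d E → ℝ} (hg : BddMeasurable g) :
    ∫ η, g η ∂(W.envLaw Q n) = ∫ η, W.trans^[n] g η ∂Q := by
  have hc := hg.comp (measurable_envProcess (d := d) (E := E) n)
  rw [envLaw, integral_map (measurable_envProcess n).aemeasurable hg.1.aestronglyMeasurable,
    jointLaw, Measure.integral_compProd]
  · exact integral_congr_ae (ae_of_all _ fun η => W.integral_quenchedLaw η n hg)
  · exact hc.integrable _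

instance isProbabilityMeasure_envLaw (Q : Measure (Env d E)) [IsProbabilityMeasure Q] (n : ℕ) :
    IsProbabilityMeasure (W.envLaw Q n) := by
  unfold envLaw jointLaw
  exact Measure.isProbabilityMeasure_map (measurable_envProcess n).aemeasurable

lemma isProbabilityMeasure_cesaro (Q : Measure (Env d E)) [IsProbabilityMeasure Q] {t : ℕ}
    (ht : t ≠ 0) : IsProbabilityMeasure (W.cesaro Q t) := by
  constructor
  simp [cesaro, ENNReal.inv_mul_cancel (Nat.cast_ne_zero.2 ht) (ENNReal.natCast_ne_top t)]

lemma integral_cesaro (Q : Measure (Env d E)) [IsProbabilityMeasure Q] (t : ℕ)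
    {g : Env d E → ℝ} (hg : BddMeasurable g) :
    ∫ η, g η ∂(W.cesaro Q t) = (t : ℝ)⁻¹ * ∑ s ∈ Finset.range t, ∫ η, W.trans^[s] g η ∂Q := by
  rw [cesaro, integral_smul_measure, integral_finsetSum_measure fun s _ => hg.integrable _]
  simp [W.integral_envLaw Q _ hg]

lemma IsInvariant.integral_trans {W : Walk d E R} {μ : Measure (Env d E)}
    [IsProbabilityMeasure μ] (h : W.IsInvariant μ) {g : Env d E → ℝ} (hg : BddMeasurable g) :
    ∫ η, W.trans g η ∂μ = ∫ η, g η ∂μ := by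
  conv_rhs => rw [← h 1, W.integral_envLaw μ 1 hg]
  rfl

end Walk

end RWRE

/-! ### Functions of few coordinates, the cone and its tail. -/

namespace RWRE

section Coordinates

variable {ι E β : Type*}

/-- Freezing the coordinates outside `S` at a reference configuration does not change `f`, and the
freezing map `e` is measurable for the coordinates in `S`. -/
lemma measurable_cylinderEvents_of_dependsOn [MeasurableSpace E] [MeasurableSpace β]
    {f : (ι → E) → β} {S : Set ι} (hf : Measurable f) (h : DependsOn f S) :
    Measurable[cylinderEvents (X := fun _ : ι => E) S] f := by
  classical
  rcases isEmpty_or_nonempty (ι → E) with hE | ⟨⟨η₀⟩⟩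
  · intro s _
    rw [Set.eq_empty_of_isEmpty (f ⁻¹' s)]
    exact @MeasurableSet.empty _ (cylinderEvents (X := fun _ : ι => E) S)
  let e : (ι → E) → ι → E := fun η p => if p ∈ S then η p else η₀ p
  have he : Measurable[cylinderEvents (X := fun _ : ι => E) S] e := by
    refine @measurable_pi_lambda _ _ _ (cylinderEvents (X := fun _ : ι => E) S) _ _ fun p => ?_
    by_cases hp : p ∈ S
    · simp only [e, hp, if_true]
      exact measurable_cylinderEvent_apply hp
    · simp only [e, hp, if_false]
      exact @measurable_const _ _ _ (cylinderEvents (X := fun _ : ι => E) S) _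
  have hfe : f = f ∘ e := by
    funext η
    exact h fun p hp => by simp [e, hp]
  rw [hfe]
  exact hf.comp he

lemma measurable_of_dependsOn_finite [Finite E] [MeasurableSpace E] [MeasurableSingletonClass E]
    [MeasurableSpace β] {f : (ι → E) → β} {S : Set ι} (hS : S.Finite) (h : DependsOn f S) :
    Measurable f := by
  rcases isEmpty_or_nonempty β with hβ | hβ
  · have : IsEmpty (ι → E) := ⟨fun x => hβ.false (f x)⟩
    exact measurable_of_empty f
  obtain ⟨g, rfl⟩ := dependsOn_iff_exists_comp.1 h
  have := hS.to_subtype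
  exact (measurable_of_countable g).comp (measurable_pi_lambda _ fun i => measurable_pi_apply _)

lemma continuous_of_dependsOn_finite [TopologicalSpace E] [DiscreteTopology E]
    [TopologicalSpace β] {f : (ι → E) → β} {S : Set ι} (hS : S.Finite) (h : DependsOn f S) :
    Continuous f := by
  rcases isEmpty_or_nonempty β with hβ | hβ
  · have : IsEmpty (ι → E) := ⟨fun x => hβ.false (f x)⟩
    exact continuous_of_const fun x => this.elim x
  obtain ⟨g, rfl⟩ := dependsOn_iff_exists_comp.1 h
  have := hS.to_subtype
  exact (continuous_of_discreteTopology (f := g)).comp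
    (continuous_pi fun i => continuous_apply _)

/-- The events that depend on finitely many coordinates, all of them in `S`. -/
def localSets (E : Type*) (S : Set ι) : Set (Set (ι → E)) :=
  {B | ∃ Λ ⊆ S, Λ.Finite ∧ DependsOn (fun η => η ∈ B) Λ}

lemma isSetAlgebra_localSets (S : Set ι) : IsSetAlgebra (localSets E S) where
  empty_mem := ⟨∅, by simp, by simp, fun _ _ _ => rfl⟩
  compl_mem := by
    rintro B ⟨Λ, hΛ, hf, h⟩
    exact ⟨Λ, hΛ, hf, fun η σ hσ => congrArg Not (h hσ)⟩
  union_mem := by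
    rintro B C ⟨Λ, hΛ, hf, h⟩ ⟨Λ', hΛ', hf', h'⟩
    refine ⟨Λ ∪ Λ', Set.union_subset hΛ hΛ', hf.union hf', fun η σ hσ => ?_⟩
    exact congrArg₂ Or (h fun i hi => hσ i (Or.inl hi)) (h' fun i hi => hσ i (Or.inr hi))

lemma measurableSet_cylinderEvents_of_dependsOn [MeasurableSpace E] {S : Set ι} {B : Set (ι → E)}
    (hB : MeasurableSet B) (h : DependsOn (fun η => η ∈ B) S) :
    MeasurableSet[cylinderEvents (X := fun _ : ι => E) S] B :=
  (@measurableSet_setOfPred _ (cylinderEvents (X := fun _ : ι => E) S) _).2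
    (measurable_cylinderEvents_of_dependsOn (measurableSet_setOfPred.1 hB) h)

variable [Finite E] [MeasurableSpace E] [MeasurableSingletonClass E]

lemma measurableSet_of_mem_localSets {S : Set ι} {B : Set (ι → E)} (hB : B ∈ localSets E S) :
    MeasurableSet B := by
  obtain ⟨Λ, -, hf, h⟩ := hB
  exact measurableSet_setOfPred.2 (measurable_of_dependsOn_finite hf h)

lemma measurableSet_cylinderEvents_of_mem_localSets {S : Set ι} {B : Set (ι → E)}
    (hB : B ∈ localSets E S) : MeasurableSet[cylinderEvents (X := fun _ : ι => E) S] B := by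
  have hm := measurableSet_of_mem_localSets hB
  obtain ⟨Λ, hΛ, hf, h⟩ := hB
  exact measurableSet_cylinderEvents_of_dependsOn hm (h.mono hΛ)

lemma generateFrom_localSets (S : Set ι) :
    cylinderEvents (X := fun _ : ι => E) S = MeasurableSpace.generateFrom (localSets E S) := by
  refine le_antisymm ?_ (MeasurableSpace.generateFrom_le fun B hB =>
    measurableSet_cylinderEvents_of_mem_localSets hB)
  refine iSup₂_le fun i hi => ?_
  rintro _ ⟨A, -, rfl⟩
  refine MeasurableSpace.measurableSet_generateFrom ⟨{i}, by simpa using hi, by simp, ?_⟩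
  intro η σ h
  simp [h i rfl]

/-- A generating algebra is dense in measure. The measure is trimmed because the local events in `S`
generate only the `σ`-algebra of `S`. -/
lemma exists_localSets_measure_symmDiff_lt (ν : Measure (ι → E)) [IsFiniteMeasure ν] {S : Set ι}
    {B : Set (ι → E)} (hB : MeasurableSet[cylinderEvents (X := fun _ : ι => E) S] B) {ε : ℝ}
    (hε : 0 < ε) : ∃ A ∈ localSets E S, ν (symmDiff B A) < ENNReal.ofReal ε := by
  have hle : cylinderEvents (X := fun _ : ι => E) S ≤ MeasurableSpace.pi := cylinderEvents_le_pi
  have hdense := @Measure.MeasureDense.of_generateFrom_isSetAlgebra_finite _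
    (cylinderEvents (X := fun _ : ι => E) S) (ν.trim hle) (localSets E S) _
    (isSetAlgebra_localSets S) (generateFrom_localSets S)
  obtain ⟨A, hA, hlt⟩ := @Measure.MeasureDense.approx _ (cylinderEvents (X := fun _ : ι => E) S) _ _
    hdense B hB (@measure_ne_top _ (cylinderEvents (X := fun _ : ι => E) S) _ _ _) ε hε
  refine ⟨A, hA, ?_⟩
  rwa [trim_measurableSet_eq hle] at hlt
  exact hB.symmDiff (measurableSet_cylinderEvents_of_mem_localSets hA)

end Coordinates

variable {d : ℕ} {E : Type*} {R : ℕ}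

/-- The space-time points at `ℓ¹`-distance at most `r` in space and in time. -/
def spaceTimeBall (d r : ℕ) : Set (SpaceTime d) := {p | normOne p.1 ≤ r ∧ |p.2| ≤ r}

lemma finite_spaceTimeBall (d r : ℕ) : (spaceTimeBall d r).Finite := by
  refine ((finite_ball d r).prod (Set.finite_Icc (-(r : ℤ)) r)).subset fun p hp => ⟨hp.1, ?_⟩
  exact abs_le.1 hp.2

lemma exists_subset_spaceTimeBall {Λ : Set (SpaceTime d)} (hΛ : Λ.Finite) :
    ∃ r, Λ ⊆ spaceTimeBall d r := by
  obtain ⟨M, hM⟩ := (hΛ.image fun p => max (normOne p.1) |p.2|).bddAbove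
  refine ⟨M.toNat, fun p hp => ?_⟩
  have h := (hM ⟨p, hp, rfl⟩).trans (Int.self_le_toNat M)
  exact ⟨(le_max_left _ _).trans h, (le_max_right _ _).trans h⟩

lemma dependsOn_comp_shift {β : Type*} {f : Env d E → β} {Λ S : Set (SpaceTime d)}
    {x : Fin d → ℤ} {t : ℤ} (hf : DependsOn f Λ) (h : ∀ p ∈ Λ, (p.1 + x, p.2 + t) ∈ S) :
    DependsOn (fun η => f (shift x t η)) S :=
  fun _ _ hS => hf fun p hp => hS _ (h p hp)

lemma Walk.dependsOn_trans (W : Walk d E R) {f : Env d E → ℝ} {Λ S : Set (SpaceTime d)}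
    (hf : DependsOn f Λ) (h0 : ∀ y ∈ box d R, (y, 0) ∈ S)
    (h1 : ∀ z ∈ ball d R, ∀ p ∈ Λ, (p.1 + z, p.2 + 1) ∈ S) : DependsOn (W.trans f) S := by
  intro η σ hS
  refine Finset.sum_congr rfl fun z hz => ?_
  congr 1
  · refine W.dependsOn_weight z fun p hp => hS p ?_
    have := h0 _ hp.1
    rwa [← hp.2] at this
  · exact dependsOn_comp_shift hf (h1 z hz) hS

/-- The first region holds the boxes read by the walk at positions of norm at most `R * p.2`, a box
adding at most `d * R`; the second is the domain of `f` carried along to time `n`. -/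
lemma Walk.dependsOn_trans_iterate (W : Walk d E R) {f : Env d E → ℝ} {r : ℕ}
    (hf : DependsOn f (spaceTimeBall d r)) (n : ℕ) :
    DependsOn (W.trans^[n] f) {p | (0 ≤ p.2 ∧ normOne p.1 ≤ R * p.2 + d * R) ∨
      (|p.2 - n| ≤ r ∧ normOne p.1 ≤ R * n + r)} := by
  induction n with
  | zero => exact hf.mono fun p hp => Or.inr (by simpa using hp.symm)
  | succ n ih =>
    rw [Function.iterate_succ_apply']
    refine W.dependsOn_trans ih (fun y hy => Or.inl ?_) fun z hz p hp => ?_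
    · simpa using normOne_le_of_mem_box hy
    · have hadd := normOne_add p.1 z
      have hz' := mem_ball.1 hz
      rcases hp with ⟨h1, h2⟩ | ⟨h1, h2⟩
      · refine Or.inl ⟨by simp only; omega, ?_⟩
        simp only
        linarith
      · refine Or.inr ⟨?_, ?_⟩
        · simpa using h1
        · simp only
          push_cast
          linarith

/-- Started from time `j`, inside the cone, the `n`-step transition probabilities of a local
function only depend on the environment far away in the cone. -/
lemma Walk.dependsOn_cone_trans_iterate (W : Walk d E R) {f : Env d E → ℝ} {r : ℕ}
    (hf : DependsOn f (spaceTimeBall d r)) (n : ℕ) {x : Fin d → ℤ} {j : ℕ} {l : ℤ}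
    (hx : normOne x ≤ R * j) (hj : (d * R : ℤ) ≤ j) (hn : ((R + 2) * r : ℤ) ≤ n + j)
    (hl : l ≤ j) (hl' : l ≤ n + j - r) :
    DependsOn (fun η => W.trans^[n] f (shift x j η)) (cone d R l) := by
  refine dependsOn_comp_shift (W.dependsOn_trans_iterate hf n) fun p hp => ?_
  have hadd := normOne_add p.1 x
  have hr : (0 : ℤ) ≤ r := by positivity
  have hR : (0 : ℤ) ≤ R := by positivity
  have hRr : (0 : ℤ) ≤ R * r := by positivity
  rcases hp with ⟨h1, h2⟩ | ⟨h1, h2⟩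
  · refine ⟨by simp only; omega, by simp only; omega, ?_⟩
    simp only
    linarith
  · obtain ⟨h3, -⟩ := abs_le.1 h1
    refine ⟨by simp only; linarith, by simp only; linarith, ?_⟩
    simp only
    -- The earliest time in this region is `n + j - r`; the cone there has radius at least `R * (n +
    -- j) + r` exactly when `(R + 2) * r ≤ n + j`.
    have : (R + 1) * (n + j - r : ℤ) ≤ (R + 1) * (p.2 + j) :=
      mul_le_mul_of_nonneg_left (by linarith) (by linarith)
    linarith

lemma cone_antitone {i j : ℤ} (h : i ≤ j) : cone d R j ⊆ cone d R i :=
  fun _ hp => ⟨hp.1, h.trans hp.2.1, hp.2.2⟩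

variable [MeasurableSpace E]

lemma coneSigma_antitone {i j : ℤ} (h : i ≤ j) : coneSigma d E R j ≤ coneSigma d E R i :=
  cylinderEvents_mono (cone_antitone h)

lemma measurableSet_coneTail {B : Set (Env d E)} : MeasurableSet[coneTail d E R] B ↔
    ∀ j : ℕ, MeasurableSet[coneSigma d E R j] B :=
  MeasurableSpace.measurableSet_iInf

lemma measurableSet_of_coneTail {B : Set (Env d E)} (hB : MeasurableSet[coneTail d E R] B) :
    MeasurableSet B :=
  cylinderEvents_le_pi _ (measurableSet_coneTail.1 hB 0)

lemma measurable_shift_cylinderEvents {S S' : Set (SpaceTime d)} {x : Fin d → ℤ} {t : ℤ}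
    (h : ∀ p ∈ S', (p.1 + x, p.2 + t) ∈ S) :
    Measurable[cylinderEvents (X := fun _ : SpaceTime d => E) S,
      cylinderEvents (X := fun _ : SpaceTime d => E) S'] (shift (E := E) x t) :=
  (@measurable_cylinderEvents_iff _ _ _ (cylinderEvents (X := fun _ : SpaceTime d => E) S)
    _ _ _).2 fun p hp => measurable_cylinderEvent_apply (h p hp)

lemma measurableSet_coneTail_preimage_shift {B : Set (Env d E)}
    (hB : MeasurableSet[coneTail d E R] B) :
    MeasurableSet[coneTail d E R] (shift 0 1 ⁻¹' B) := by
  refine measurableSet_coneTail.2 fun j =>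
    measurable_shift_cylinderEvents ?_ (measurableSet_coneTail.1 hB j)
  rintro p ⟨h1, h2, h3⟩
  refine ⟨by simp only; omega, by simp only; omega, ?_⟩
  simp only [add_zero]
  linarith [(by positivity : (0 : ℤ) ≤ R)]

/-- The union of an increasing sequence of events that eventually belong to each of the cone
`σ`-algebras belongs to the tail. -/
lemma measurableSet_coneTail_iUnion {N : ℕ → Set (Env d E)} (hmono : Monotone N)
    (h : ∀ l : ℕ, ∃ J₀, ∀ J ≥ J₀, MeasurableSet[coneSigma d E R l] (N J)) :
    MeasurableSet[coneTail d E R] (⋃ J, N J) := by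
  refine measurableSet_coneTail.2 fun l => ?_
  obtain ⟨J₀, hJ₀⟩ := h l
  have : ⋃ J, N J = ⋃ J, N (J₀ + J) := by
    refine subset_antisymm (Set.iUnion_subset fun J => ?_)
      (Set.iUnion_subset fun J => Set.subset_iUnion N _)
    exact (hmono (Nat.le_add_left J J₀)).trans (Set.subset_iUnion (fun J => N (J₀ + J)) J)
  rw [this]
  exact MeasurableSet.iUnion fun J => hJ₀ _ (Nat.le_add_right _ _)

end RWRE

/-! ### Observations along paths and the effect of cone mixing on the walk. -/

namespace RWRE

variable {d : ℕ} {E : Type*} {R : ℕ}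

/-- The space-time points seen along the last `k` steps of `γ`. -/
def observed (R k : ℕ) (γ : ℤ → Fin d → ℤ) : Set (SpaceTime d) :=
  ⋃ i ∈ Set.Icc (-k : ℤ) (-1), (fun y => ((γ i + y, i) : SpaceTime d)) '' box d R

lemma finite_observed (R k : ℕ) (γ : ℤ → Fin d → ℤ) : (observed R k γ).Finite :=
  (Set.finite_Icc _ _).biUnion fun _ _ => (finite_box d R).image _

lemma mem_observed {k : ℕ} {γ : ℤ → Fin d → ℤ} {p : SpaceTime d} : p ∈ observed R k γ ↔
    ∃ i : ℤ, -k ≤ i ∧ i ≤ -1 ∧ ∃ y ∈ box d R, (γ i + y, i) = p := by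
  simp [observed, and_assoc]

/-- Patterns in `observation` are relative to `γ_i`. Recentring one global configuration makes them
consistent where boxes overlap, so every realized pattern on the observed set is an observation. -/
lemma observation_comp_shift (k : ℕ) (γ : ℤ → Fin d → ℤ) (σ : Env d E) :
    observation R k γ (fun p => σ (γ p.2 + p.1, p.2)) =
      {η | ∀ p ∈ observed R k γ, η p = σ p} := by
  ext η
  simp only [observation, Set.mem_ofPred_eq, mem_observed]
  constructor
  · rintro h _ ⟨i, hi, hi', y, hy, rfl⟩
    simpa [shift, add_comm] using h i hi hi' y hy
  · intro h i hi hi' y hy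
    simpa [shift, add_comm] using h _ ⟨i, hi, hi', y, hy, rfl⟩

variable [MeasurableSpace E]

lemma TranslationInvariant.measurePreserving {P : Measure (Env d E)} (hP : TranslationInvariant P)
    (x : Fin d → ℤ) (t : ℤ) : MeasurePreserving (shift x t) P P :=
  ⟨measurable_shift x t, hP x t⟩

lemma TranslationInvariant.integral_shift {P : Measure (Env d E)} (hP : TranslationInvariant P)
    (x : Fin d → ℤ) (t : ℤ) {g : Env d E → ℝ} (hg : BddMeasurable g) :
    ∫ η, g (shift x t η) ∂P = ∫ η, g η ∂P := by
  conv_rhs => rw [← hP x t]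
  rw [integral_map (measurable_shift x t).aemeasurable hg.1.aestronglyMeasurable]

lemma Walk.ConeMixing.exists_forall_le {W : Walk d E R} {P : Measure (Env d E)}
    (hmix : W.ConeMixing P) {ε : ℝ} (hε : 0 < ε) :
    ∃ l : ℕ, ∀ B, MeasurableSet[coneSigma d E R l] B → ∀ A ∈ W.possibleObservations P,
      |(P[|A]).real B - P.real B| ≤ ε := by
  have h := hmix.eventually (ge_mem_nhds (ENNReal.ofReal_pos.2 hε))
  obtain ⟨l, hl⟩ := h.exists
  refine ⟨l, fun B hB A hA => ?_⟩
  rw [← ENNReal.ofReal_le_ofReal_iff hε.le]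
  refine le_trans ?_ hl
  exact le_iSup₂_of_le B hB (le_iSup₂_of_le A hA le_rfl)

variable [Finite E] [MeasurableSingletonClass E]

/-- Only finitely many patterns can be observed, so `F` is a nonnegative combination of their
indicators; each pattern is either null or a possible observation. -/
lemma Walk.abs_integral_mul_le_of_observed (W : Walk d E R) (P : Measure (Env d E))
    [IsProbabilityMeasure P] {h : Env d E → ℝ} (hh : BddMeasurable h) {ε : ℝ} (hε : 0 ≤ ε)
    (h0 : ∫ η, h η ∂P = 0)
    (hA : ∀ A ∈ W.possibleObservations P, |∫ η in A, h η ∂P| ≤ ε * P.real A)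
    {k : ℕ} {γ : ℤ → Fin d → ℤ} (hγ : W.IsBackwardPath k γ) {F : Env d E → ℝ}
    (hF : ∀ η, 0 ≤ F η) (hdep : DependsOn F (observed R k γ)) :
    |∫ η, F η * h η ∂P| ≤ ε * ∫ η, F η ∂P := by
  classical
  rcases Nat.eq_zero_or_pos k with rfl | hk
  -- The empty history is not a possible observation, which requires `k ≥ 1`; here `F` is constant
  -- and the centring of `h` is used instead.
  · obtain ⟨η₀⟩ : Nonempty (Env d E) := nonempty_of_isProbabilityMeasure P
    have hc : ∀ η, F η = F η₀ := fun η => hdep fun p hp => by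
      obtain ⟨i, hi, hi', -⟩ := mem_observed.1 hp
      simp only [Nat.cast_zero] at hi
      omega
    simp_rw [hc, integral_const_mul, h0]
    simpa using mul_nonneg hε (hF η₀)
  have hfin := finite_observed R k γ
  have := hfin.to_subtype
  have := Fintype.ofFinite (observed R k γ → E)
  obtain ⟨g, rfl⟩ := dependsOn_iff_exists_comp.1 hdep
  set r : Env d E → (observed R k γ → E) := (observed R k γ).domRestrict with hr
  have hrm : Measurable r := measurable_pi_lambda _ fun i => measurable_pi_apply _
  have hg : ∀ q : Env d E → ℝ, BddMeasurable q →
      ∫ η, (g ∘ r) η * q η ∂P = ∑ π, g π * ∫ η in r ⁻¹' {π}, q η ∂P := by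
    intro q hq
    have hind : ∀ π, MeasurableSet (r ⁻¹' {π}) := fun π => hrm (measurableSet_singleton π)
    have : ∀ η, (g ∘ r) η * q η = ∑ π, g π * (r ⁻¹' {π}).indicator q η := by
      intro η
      rw [Finset.sum_eq_single (r η)]
      · simp
      · intro π _ hπ
        rw [Set.indicator_of_notMem (by simpa using hπ.symm), mul_zero]
      · simp
    simp_rw [this]
    rw [integral_finsetSum _ fun π _ => (((hq.integrable P).indicator (hind π)).const_mul _)]
    simp_rw [integral_const_mul, integral_indicator (hind _)]
  have h1 := hg (fun _ => 1) (BddMeasurable.const 1)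
  simp only [mul_one] at h1
  rw [hg h hh, h1, Finset.mul_sum]
  refine (Finset.abs_sum_le_sum_abs _ _).trans (Finset.sum_le_sum fun π _ => ?_)
  rcases eq_or_ne (P (r ⁻¹' {π})) 0 with h0 | hpos
  · rw [setIntegral_measure_zero _ h0, setIntegral_measure_zero _ h0]
    simp
  obtain ⟨σ, hσ⟩ := nonempty_of_measure_ne_zero hpos
  have hmem : r ⁻¹' {π} ∈ W.possibleObservations P := by
    refine ⟨k, hk, γ, hγ, fun p => σ (γ p.2 + p.1, p.2), ?_, pos_iff_ne_zero.2 hpos⟩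
    rw [observation_comp_shift]
    ext η
    simp only [Set.mem_preimage, Set.mem_singleton_iff] at hσ ⊢
    rw [← hσ, funext_iff]
    simp [hr]
  have hgπ : 0 ≤ g π := by
    have := hF σ
    rwa [Function.comp_apply, show r σ = π from hσ] at this
  rw [abs_mul, abs_of_nonneg hgπ]
  calc g π * |∫ η in r ⁻¹' {π}, h η ∂P| ≤ g π * (ε * P.real (r ⁻¹' {π})) :=
        mul_le_mul_of_nonneg_left (hA _ hmem) hgπ
    _ = ε * (g π * ∫ η in r ⁻¹' {π}, (1 : ℝ) ∂P) := by
        rw [setIntegral_const]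
        simp only [smul_eq_mul, mul_one]
        ring

/-- Each application of `T` is absorbed into the past: after a jump `z`, translation invariance
recentres at the new position, and `F` times the jump weight becomes a function of a history one
step longer. The weights sum to one, so the total mass of `F` is preserved and `ε` does not grow
with `m`. -/
lemma Walk.abs_integral_mul_trans_iterate_le (W : Walk d E R) {P : Measure (Env d E)}
    [IsProbabilityMeasure P] (hP : TranslationInvariant P) {h : Env d E → ℝ}
    (hh : BddMeasurable h) {ε : ℝ} (hε : 0 ≤ ε) (h0 : ∫ η, h η ∂P = 0)
    (hA : ∀ A ∈ W.possibleObservations P, |∫ η in A, h η ∂P| ≤ ε * P.real A) (m : ℕ)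
    {k : ℕ} {γ : ℤ → Fin d → ℤ} (hγ : W.IsBackwardPath k γ) {F : Env d E → ℝ}
    (hF : ∀ η, 0 ≤ F η) (hFm : BddMeasurable F) (hdep : DependsOn F (observed R k γ)) :
    |∫ η, F η * W.trans^[m] h η ∂P| ≤ ε * ∫ η, F η ∂P := by
  induction m generalizing k γ F with
  | zero => exact W.abs_integral_mul_le_of_observed P hh hε h0 hA hγ hF hdep
  | succ m ih =>
    rw [Function.iterate_succ_apply']
    set g := W.trans^[m] h with hg
    have hgm : BddMeasurable g := W.bddMeasurable_trans_iterate hh m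
    have hFw : ∀ z, BddMeasurable fun η => F η * W.weight z η :=
      fun z => hFm.mul (W.bddMeasurable_weight z)
    let G : (Fin d → ℤ) → Env d E → ℝ :=
      fun z η => F (shift (-z) (-1) η) * W.weight z (shift (-z) (-1) η)
    have hG : ∀ z, BddMeasurable (G z) := fun z => (hFw z).comp (measurable_shift (-z) (-1))
    have hGi : ∀ z, ∫ η, G z η ∂P = ∫ η, F η * W.weight z η ∂P :=
      fun z => hP.integral_shift (-z) (-1) (hFw z)
    have hsplit : ∫ η, F η * W.trans g η ∂P = ∑ z ∈ ball d R, ∫ η, G z η * g η ∂P := by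
      simp_rw [trans, Finset.mul_sum, ← mul_assoc]
      rw [integral_finsetSum _ fun z _ =>
        ((hFw z).mul (hgm.comp (measurable_shift z 1))).integrable P]
      refine Finset.sum_congr rfl fun z _ => ?_
      rw [← hP.integral_shift (-z) (-1) ((hFw z).mul (hgm.comp (measurable_shift z 1)))]
      simp [G, shift_shift]
    have htot : ∫ η, F η ∂P = ∑ z ∈ ball d R, ∫ η, G z η ∂P := by
      simp_rw [hGi]
      rw [← integral_finsetSum _ fun z _ => (hFw z).integrable P]
      simp_rw [← Finset.mul_sum, W.sum_weight, mul_one]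
    rw [hsplit, htot, Finset.mul_sum]
    refine (Finset.abs_sum_le_sum_abs _ _).trans (Finset.sum_le_sum fun z _ => ?_)
    by_cases hz : z ∈ W.jumps
    -- The old history moves by `(-z, -1)`, so the old origin becomes `γ' (-1) = -z`; the new last
    -- step is the jump `z` to the origin.
    · let γ' : ℤ → Fin d → ℤ := fun i => if i = 0 then 0 else γ (i + 1) - z
      refine ih (k := k + 1) (γ := γ') ⟨by simp [γ'], fun i hi hi' => ?_⟩
        (fun η => mul_nonneg (hF _) (W.weight_nonneg _ _)) (hG z) ?_
      · rcases eq_or_ne i (-1) with rfl | hne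
        · simpa [γ', hγ.1] using hz
        · have h1 : i + 1 ≠ 0 := by omega
          simp only [γ', h1, hi'.ne, if_false, sub_sub_sub_cancel_right]
          push_cast at hi
          exact hγ.2 (i + 1) (by omega) (by omega)
      · have hF' : DependsOn (fun η => F (shift (-z) (-1) η)) (observed R (k + 1) γ') := by
          refine dependsOn_comp_shift hdep fun p hp => ?_
          obtain ⟨i, hi, hi', y, hy, rfl⟩ := mem_observed.1 hp
          refine mem_observed.2 ⟨i - 1, by push_cast; omega, by omega, y, hy, ?_⟩
          have h1 : i - 1 ≠ 0 := by omega
          simp only [γ', h1, if_false, sub_add_cancel]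
          ext1
          · simp only; abel
          · simp only; ring
        have hw : DependsOn (fun η => W.weight z (shift (-z) (-1) η))
            (observed R (k + 1) γ') := by
          refine dependsOn_comp_shift (W.dependsOn_weight z) ?_
          rintro ⟨y, s⟩ ⟨hy, hs⟩
          refine mem_observed.2 ⟨-1, by push_cast; omega, le_rfl, y, hy, ?_⟩
          simp only at hs
          simp only [γ', hs]
          ext1
          · simp [hγ.1, add_comm]
          · simp
        exact fun η σ hσ => congrArg₂ (· * ·) (hF' hσ) (hw hσ)
    · have : ∀ η, G z η = 0 := fun η => by
        by_contra hne
        exact hz (W.mem_jumps_of_weight_ne_zero (right_ne_zero_of_mul hne))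
      simp [this]

/-- Along the environment process started from `P`, the law on the far part of the cone stays
close to `P`. -/
lemma Walk.abs_integral_trans_iterate_indicator_sub_le (W : Walk d E R) {P : Measure (Env d E)}
    [IsProbabilityMeasure P] (hP : TranslationInvariant P) {ε : ℝ} (hε : 0 ≤ ε)
    {B : Set (Env d E)} (hB : MeasurableSet B)
    (h : ∀ A ∈ W.possibleObservations P, |(P[|A]).real B - P.real B| ≤ ε) (m : ℕ) :
    |∫ η, W.trans^[m] (B.indicator 1) η ∂P - P.real B| ≤ ε := by
  have hBm := BddMeasurable.indicator hB
  have hq : BddMeasurable fun η => B.indicator (1 : Env d E → ℝ) η - P.real B := by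
    simpa [sub_eq_add_neg] using hBm.add (BddMeasurable.const (-P.real B))
  have hconst : W.trans^[m] (fun _ => P.real B) = fun _ => P.real B :=
    Function.iterate_fixed (W.trans_const _) m
  -- The walk starts with no history, that is, with `F = 1` and `k = 0`.
  have key := W.abs_integral_mul_trans_iterate_le hP hq hε ?_ ?_ m (k := 0) (γ := fun _ => 0)
    (F := fun _ => 1) ⟨rfl, by intro i hi hi'; simp at hi; omega⟩ (fun _ => zero_le_one)
    (BddMeasurable.const 1) (fun _ _ _ => rfl)
  · simp only [one_mul, W.trans_iterate_sub, hconst, integral_const, probReal_univ, smul_eq_mul,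
      mul_one] at key
    rwa [integral_sub ((W.bddMeasurable_trans_iterate hBm m).integrable P)
      (integrable_const _), integral_const, probReal_univ, one_smul] at key
  · rw [integral_sub (hBm.integrable P) (integrable_const _), integral_indicator_one hB]
    simp
  · intro A hA
    have hpos : 0 < P.real A := by
      obtain ⟨-, -, -, -, -, -, hpos⟩ := hA
      exact ENNReal.toReal_pos hpos.ne' (measure_ne_top _ _)
    have hAm : MeasurableSet A := by
      obtain ⟨k, -, γ, -, σ, rfl, -⟩ := hA
      refine measurableSet_of_mem_localSets (S := Set.univ)
        ⟨observed R k γ, Set.subset_univ _, finite_observed R k γ, fun η η' hη => ?_⟩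
      simp only [observation, Set.mem_ofPred_eq]
      refine propext (forall₅_congr fun i hi hi' y hy => ?_)
      rw [shift, shift, hη]
      exact mem_observed.2 ⟨i, hi, hi', y, hy, by simp [add_comm]⟩
    have hc := h A hA
    rw [measureReal_def, cond_apply hAm, ENNReal.toReal_mul, ENNReal.toReal_inv,
      ← measureReal_def, ← measureReal_def] at hc
    rw [integral_sub (hBm.integrable P).integrableOn (integrable_const _),
      integral_indicator_one hB, setIntegral_const, smul_eq_mul, measureReal_restrict_apply hB]
    have : P.real (B ∩ A) - P.real A * P.real B =
        P.real A * ((P.real A)⁻¹ * P.real (A ∩ B) - P.real B) := by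
      rw [Set.inter_comm]
      field_simp
    rw [this, abs_mul, abs_of_pos hpos, mul_comm]
    exact mul_le_mul_of_nonneg_right hc hpos.le

end RWRE

/-! ### Existence of an invariant law. -/

namespace RWRE

variable {d : ℕ} {E : Type*} {R : ℕ}

lemma borelSpace_of_finite_of_discrete [Finite E] [MeasurableSpace E] [MeasurableSingletonClass E]
    [TopologicalSpace E] [DiscreteTopology E] : BorelSpace E := by
  refine ⟨le_antisymm (fun s _ => ?_) (fun s _ => (Set.toFinite s).measurableSet)⟩
  exact MeasurableSpace.measurableSet_generateFrom (isOpen_discrete s)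

/-- A uniform bound on the difference of two measures extends from the local events to the
`σ`-algebra they generate. -/
lemma abs_measureReal_sub_le_of_localSets {ι : Type*} [Finite E] [MeasurableSpace E]
    [MeasurableSingletonClass E] {μ ν : Measure (ι → E)} [IsFiniteMeasure μ] [IsFiniteMeasure ν]
    {S : Set ι} {ε : ℝ} (h : ∀ A ∈ localSets E S, |μ.real A - ν.real A| ≤ ε) {B : Set (ι → E)}
    (hB : MeasurableSet[cylinderEvents (X := fun _ : ι => E) S] B) :
    |μ.real B - ν.real B| ≤ ε := by
  refine le_of_forall_pos_le_add fun δ hδ => ?_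
  -- Approximating for the sum makes one local event good for both measures.
  obtain ⟨A, hA, hlt⟩ := exists_localSets_measure_symmDiff_lt (μ + ν) hB (half_pos hδ)
  have hAm := measurableSet_of_mem_localSets hA
  have hBm : MeasurableSet B := cylinderEvents_le_pi _ hB
  have hle : ∀ ρ : Measure (ι → E), IsFiniteMeasure ρ → ρ ≤ μ + ν →
      |ρ.real B - ρ.real A| ≤ δ / 2 := by
    intro ρ _ hρ
    refine (abs_measureReal_sub_le_measureReal_symmDiff hBm.nullMeasurableSet
      hAm.nullMeasurableSet).trans ?_
    exact ENNReal.toReal_le_of_le_ofReal (half_pos hδ).le ((hρ _).trans hlt.le)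
  have h1 := abs_le.1 (hle μ inferInstance (Measure.le_add_right le_rfl))
  have h2 := abs_le.1 (hle ν inferInstance (Measure.le_add_left le_rfl))
  have h3 := abs_le.1 (h A hA)
  rw [abs_le]
  constructor <;> linarith [h1.1, h1.2, h2.1, h2.2, h3.1, h3.2]

namespace Walk

variable (W : Walk d E R)

lemma finite_weight_domain (d R : ℕ) :
    {p : SpaceTime d | p.1 ∈ box d R ∧ p.2 = 0}.Finite :=
  ((finite_box d R).prod (Set.finite_singleton 0)).subset fun _ hp => hp

section Continuity

variable [TopologicalSpace E] [DiscreteTopology E]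

lemma continuous_weight (z : Fin d → ℤ) : Continuous (W.weight z) :=
  continuous_of_dependsOn_finite (finite_weight_domain d R) (W.dependsOn_weight z)

lemma continuous_trans {f : Env d E → ℝ} (hf : Continuous f) : Continuous (W.trans f) := by
  refine continuous_finsetSum _ fun z _ => (W.continuous_weight z).mul (hf.comp ?_)
  exact continuous_pi fun p => continuous_apply _

lemma continuous_trans_iterate {f : Env d E → ℝ} (hf : Continuous f) (n : ℕ) :
    Continuous (W.trans^[n] f) := by
  induction n with
  | zero => exact hf
  | succ n ih =>
    rw [Function.iterate_succ_apply']
    exact W.continuous_trans ih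

end Continuity

variable [MeasurableSpace E] [Finite E] [MeasurableSingletonClass E]

/-- The sum telescopes, leaving only the first and last of the terms, each bounded by `C`. -/
lemma abs_integral_cesaro_trans_sub_le (Q : Measure (Env d E)) [IsProbabilityMeasure Q] (t : ℕ)
    {g : Env d E → ℝ} (hg : Measurable g) {C : ℝ} (hC : ∀ η, |g η| ≤ C) :
    |∫ η, W.trans g η ∂(W.cesaro Q t) - ∫ η, g η ∂(W.cesaro Q t)| ≤ (t : ℝ)⁻¹ * (2 * C) := by
  have hgb : BddMeasurable g := ⟨hg, C, hC⟩
  have hb : ∀ n, |∫ η, W.trans^[n] g η ∂Q| ≤ C := fun n => by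
    refine (abs_integral_le_integral_abs).trans ?_
    refine (integral_mono_of_nonneg (ae_of_all _ fun _ => abs_nonneg _) (integrable_const C)
      (ae_of_all _ (W.abs_trans_iterate_le hC n))).trans ?_
    simp
  rw [W.integral_cesaro Q t (W.bddMeasurable_trans hgb), W.integral_cesaro Q t hgb, ← mul_sub,
    ← Finset.sum_sub_distrib]
  simp_rw [← Function.iterate_succ_apply]
  rw [Finset.sum_range_sub (fun n => ∫ η, W.trans^[n] g η ∂Q), abs_mul,
    abs_of_nonneg (by positivity : (0 : ℝ) ≤ (t : ℝ)⁻¹)]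
  refine mul_le_mul_of_nonneg_left ?_ (by positivity)
  have h1 := abs_le.1 (hb t)
  have h2 := abs_le.1 (hb 0)
  rw [abs_le]
  constructor <;> linarith [h1.1, h1.2, h2.1, h2.2]

/-- By the Feller property `T^n f` is again bounded continuous, so the one-step identity iterates;
bounded continuous functions determine the law. -/
lemma isInvariant_of_integral_trans [TopologicalSpace E] [DiscreteTopology E]
    {μ : Measure (Env d E)} [IsProbabilityMeasure μ]
    (h : ∀ f : Env d E →ᵇ ℝ, ∫ η, W.trans f η ∂μ = ∫ η, f η ∂μ) : W.IsInvariant μ := by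
  have := borelSpace_of_finite_of_discrete (E := E)
  intro n
  refine ext_of_forall_integral_eq_of_IsFiniteMeasure fun f => ?_
  have hf : BddMeasurable f := ⟨f.continuous.measurable, ‖f‖, f.norm_coe_le_norm⟩
  rw [W.integral_envLaw μ n hf]
  induction n with
  | zero => rfl
  | succ n ih =>
    rw [Function.iterate_succ_apply', ← ih]
    exact h (BoundedContinuousFunction.ofNormedAddCommGroup _
      (W.continuous_trans_iterate f.continuous n) ‖f‖
      (W.abs_trans_iterate_le f.norm_coe_le_norm n))

/-- Weak limits of the Cesàro averages along an ultrafilter exist. -/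
lemma exists_tendsto_integral_cesaro [TopologicalSpace E] [DiscreteTopology E]
    (Q : Measure (Env d E)) [IsProbabilityMeasure Q] :
    ∃ (μ : Measure (Env d E)) (U : Ultrafilter ℕ), IsProbabilityMeasure μ ∧ (U : Filter ℕ) ≤ atTop ∧
      ∀ f : Env d E →ᵇ ℝ,
        Tendsto (fun t => ∫ η, f η ∂(W.cesaro Q (t + 1))) U (𝓝 (∫ η, f η ∂μ)) := by
  have := borelSpace_of_finite_of_discrete (E := E)
  -- The index is moved by one because the Cesàro average over zero terms is the zero measure. The
  -- space of probability measures on a compact space is compact, so the ultrafilter converges.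
  let ρ : ℕ → ProbabilityMeasure (Env d E) :=
    fun t => ⟨W.cesaro Q (t + 1), W.isProbabilityMeasure_cesaro Q t.succ_ne_zero⟩
  let U : Ultrafilter ℕ := Ultrafilter.of atTop
  obtain ⟨μ, -, hμ⟩ := (isCompact_univ (X := ProbabilityMeasure (Env d E))).ultrafilter_le_nhds
    (U.map ρ) (by simp)
  refine ⟨μ, U, inferInstance, Ultrafilter.of_le _, ?_⟩
  exact ProbabilityMeasure.tendsto_iff_forall_integral_tendsto.1 (show Tendsto ρ U (𝓝 μ) from hμ)

/-- Existence of an invariant law that agrees with the environment law on the tail. -/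
theorem exists_isInvariant [TopologicalSpace E] [DiscreteTopology E] {P : Measure (Env d E)}
    [IsProbabilityMeasure P] (hP : TranslationInvariant P) (hmix : W.ConeMixing P) :
    ∃ μ : Measure (Env d E), IsProbabilityMeasure μ ∧ W.IsInvariant μ ∧
      ∀ B, MeasurableSet[coneTail d E R] B → μ B = P B := by
  have := borelSpace_of_finite_of_discrete (E := E)
  obtain ⟨μ, U, hμ, hU, hlim⟩ := W.exists_tendsto_integral_cesaro P
  refine ⟨μ, hμ, W.isInvariant_of_integral_trans fun f => ?_, fun B hB => ?_⟩
  · let Tf : Env d E →ᵇ ℝ := BoundedContinuousFunction.ofNormedAddCommGroup _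
      (W.continuous_trans f.continuous) ‖f‖ (W.abs_trans_le f.norm_coe_le_norm)
    have h1 := (hlim Tf).sub (hlim f)
    have h2 : Tendsto (fun t : ℕ => ((t + 1 : ℕ) : ℝ)⁻¹ * (2 * ‖f‖)) U (𝓝 0) := by
      have := (((tendsto_natCast_atTop_atTop (R := ℝ)).comp
        (tendsto_add_atTop_nat 1)).inv_tendsto_atTop).mul_const (2 * ‖f‖)
      rw [zero_mul] at this
      exact this.mono_left hU
    have h3 : Tendsto (fun t => ∫ η, Tf η ∂(W.cesaro P (t + 1)) -
        ∫ η, f η ∂(W.cesaro P (t + 1))) U (𝓝 0) := squeeze_zero_norm (fun t =>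
        W.abs_integral_cesaro_trans_sub_le P (t + 1)
      f.continuous.measurable f.norm_coe_le_norm) h2
    exact sub_eq_zero.1 (tendsto_nhds_unique h1 h3)
  · have hreal : μ.real B = P.real B := by
      refine eq_of_abs_sub_nonpos (le_of_forall_pos_le_add fun ε hε => ?_)
      rw [zero_add]
      obtain ⟨l, hl⟩ := hmix.exists_forall_le hε
      -- A weak limit controls only events with continuous indicator, and a tail event is not of
      -- this kind; local events in the cone are, and the uniform bound extends from them.
      refine abs_measureReal_sub_le_of_localSets (fun A hA => ?_) (measurableSet_coneTail.1 hB l)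
      have hAm := measurableSet_of_mem_localSets hA
      have hAc : Continuous (A.indicator (1 : Env d E → ℝ)) := by
        classical
        obtain ⟨Λ, -, hΛ, hdep⟩ := hA
        refine continuous_of_dependsOn_finite hΛ fun η σ h => ?_
        have : (η ∈ A) = (σ ∈ A) := hdep h
        simp [Set.indicator_apply, this]
      have hb := BddMeasurable.indicator hAm
      let fA : Env d E →ᵇ ℝ := BoundedContinuousFunction.ofNormedAddCommGroup _ hAc 1 fun η => by
        by_cases h : η ∈ A <;> simp [h]
      have hfA : ∀ ρ : Measure (Env d E), ∫ η, fA η ∂ρ = ρ.real A :=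
        fun ρ => integral_indicator_one hAm
      have ht := ((hlim fA).sub_const (P.real A)).abs
      rw [hfA] at ht
      refine le_of_tendsto ht (Eventually.of_forall fun t => ?_)
      change |∫ η, A.indicator 1 η ∂(W.cesaro P (t + 1)) - P.real A| ≤ ε
      rw [W.integral_cesaro P (t + 1) hb]
      have hpos : (0 : ℝ) < ((t + 1 : ℕ) : ℝ) := by positivity
      have hsum : |∑ s ∈ Finset.range (t + 1),
          (∫ η, W.trans^[s] (A.indicator 1) η ∂P - P.real A)| ≤ ((t + 1 : ℕ) : ℝ) * ε := by
        refine (Finset.abs_sum_le_sum_abs _ _).trans ?_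
        refine (Finset.sum_le_card_nsmul _ _ ε fun s _ => ?_).trans (by simp)
        exact W.abs_integral_trans_iterate_indicator_sub_le hP hε.le hAm
          (hl A (measurableSet_cylinderEvents_of_mem_localSets hA)) s
      rw [Finset.sum_sub_distrib, Finset.sum_const, Finset.card_range, nsmul_eq_mul] at hsum
      have : ((t + 1 : ℕ) : ℝ)⁻¹ * ∑ s ∈ Finset.range (t + 1),
          ∫ η, W.trans^[s] (A.indicator 1) η ∂P - P.real A = ((t + 1 : ℕ) : ℝ)⁻¹ *
            (∑ s ∈ Finset.range (t + 1), ∫ η, W.trans^[s] (A.indicator 1) η ∂P -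
              ((t + 1 : ℕ) : ℝ) * P.real A) := by
        field_simp
      rw [this, abs_mul, abs_of_pos (inv_pos.2 hpos), inv_mul_le_iff₀ hpos]
      exact hsum
    exact (measureReal_eq_measureReal_iff).1 hreal

end Walk

end RWRE

/-! ### Ellipticity and ergodicity of the invariant law. -/

namespace RWRE

variable {d : ℕ} {E : Type*} {R : ℕ}

namespace Walk

variable {W : Walk d E R}

/-- The weight is a continuous positive function on a compact space, so it attains a positive
minimum. -/
lemma EllipticInTime.exists_le_weight [Finite E] [TopologicalSpace E] [DiscreteTopology E]
    [Nonempty (Env d E)] (h : W.EllipticInTime) :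
    ∃ ε > 0, ∀ η, ε ≤ W.weight 0 η := by
  obtain ⟨η₀, -, hη₀⟩ := isCompact_univ.exists_isMinOn Set.univ_nonempty
    (W.continuous_weight 0).continuousOn
  exact ⟨W.weight 0 η₀, ENNReal.toReal_pos (h η₀).ne' ((W.prob η₀).apply_ne_top 0),
    fun η => hη₀ (Set.mem_univ η)⟩

lemma weight_mul_le_trans {g : Env d E → ℝ} (hg : ∀ η, 0 ≤ g η) (η : Env d E) :
    W.weight 0 η * g (shift 0 1 η) ≤ W.trans g η :=
  Finset.single_le_sum (f := fun z => W.weight z η * g (shift z 1 η))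
    (fun z _ => mul_nonneg (W.weight_nonneg z η) (hg _)) (mem_ball.2 (by simp))

/-- `T 1_A` averages values in `[0, 1]`; when the average is `0` or `1`, every jump of positive
weight must give that value, in particular the jump `0`. -/
lemma indicator_shift_eq (hell : W.EllipticInTime) {A : Set (Env d E)} {η : Env d E}
    (h : W.trans (A.indicator 1) η = A.indicator 1 η) : shift 0 1 η ∈ A ↔ η ∈ A := by
  have hpos : 0 < W.weight 0 η := ENNReal.toReal_pos (hell η).ne' ((W.prob η).apply_ne_top 0)
  have h0 : ∀ σ, 0 ≤ A.indicator (1 : Env d E → ℝ) σ :=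
    fun σ => Set.indicator_nonneg (fun _ _ => zero_le_one) σ
  have h1 : ∀ σ, 0 ≤ 1 - A.indicator (1 : Env d E → ℝ) σ := fun σ => by
    by_cases hσ : σ ∈ A <;> simp [hσ]
  by_cases hη : η ∈ A
  · have h2 := weight_mul_le_trans (W := W) h1 η
    rw [W.trans_sub, W.trans_const] at h2
    simp only [h, hη, Set.indicator_of_mem, Pi.one_apply, sub_self] at h2
    by_contra hc
    have h3 : shift 0 1 η ∉ A := fun h3 => hc (by simp [h3, hη])
    simp only [h3, not_false_eq_true, Set.indicator_of_notMem, sub_zero, mul_one] at h2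
    linarith
  · have h2 := weight_mul_le_trans (W := W) h0 η
    simp only [h, hη, not_false_eq_true, Set.indicator_of_notMem] at h2
    by_contra hc
    have h3 : shift 0 1 η ∈ A := by
      by_contra h3
      exact hc (by simp [h3, hη])
    simp only [h3, Set.indicator_of_mem, Pi.one_apply, mul_one] at h2
    linarith

end Walk

variable [MeasurableSpace E]

lemma ErgodicInTime.preErgodic {P : Measure (Env d E)} [IsProbabilityMeasure P]
    (h : ErgodicInTime P) : PreErgodic (shift (E := E) (0 : Fin d → ℤ) 1) P := by
  refine ⟨fun {B} hB hinv => ?_⟩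
  have hB' : shift 0 (-1) ⁻¹' B = B := by
    conv_lhs => rw [← hinv]
    ext η
    simp [shift_shift]
  rw [eventuallyConst_set']
  rcases h B hB hB' with h0 | h1
  · exact Or.inl (ae_eq_empty.2 h0)
  · exact Or.inr (ae_eq_univ.2 ((prob_compl_eq_zero_iff hB).2 h1))

namespace Walk

variable [Finite E] [MeasurableSingletonClass E] {W : Walk d E R}

variable {μ : Measure (Env d E)} [IsProbabilityMeasure μ]

/-- Keeping only the jump `0` gives `ε g(θ_{o,1} η) ≤ T g(η)`, and `T` preserves the integral. This
replaces the missing shift invariance of `μ`. -/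
lemma IsInvariant.pow_mul_integral_shift_le (hμ : W.IsInvariant μ) {ε : ℝ} (hε : 0 < ε)
    (hW : ∀ η, ε ≤ W.weight 0 η) {g : Env d E → ℝ} (hg : BddMeasurable g)
    (h0 : ∀ η, 0 ≤ g η) (j : ℕ) :
    ε ^ j * ∫ η, g (shift 0 j η) ∂μ ≤ ∫ η, g η ∂μ := by
  induction j generalizing g with
  | zero => simp
  | succ j ih =>
    have hg' := hg.comp (measurable_shift (E := E) (0 : Fin d → ℤ) 1)
    have h1 := ih hg' fun η => h0 _
    have h2 : ε * ∫ η, g (shift 0 1 η) ∂μ ≤ ∫ η, g η ∂μ := by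
      rw [← hμ.integral_trans hg, ← integral_const_mul]
      refine integral_mono ((hg'.integrable μ).const_mul ε)
        ((W.bddMeasurable_trans hg).integrable μ) fun η => ?_
      exact (mul_le_mul_of_nonneg_right (hW η) (h0 _)).trans (weight_mul_le_trans h0 η)
    simp only [shift_shift, add_zero] at h1
    rw [pow_succ', mul_assoc]
    push_cast
    exact (mul_le_mul_of_nonneg_left h1 hε.le).trans h2

lemma IsInvariant.quasiMeasurePreserving_shift (hμ : W.IsInvariant μ) {ε : ℝ} (hε : 0 < ε)
    (hW : ∀ η, ε ≤ W.weight 0 η) (j : ℕ) :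
    Measure.QuasiMeasurePreserving (shift (E := E) (0 : Fin d → ℤ) j) μ μ := by
  refine ⟨measurable_shift 0 j, Measure.AbsolutelyContinuous.mk fun B hB h0 => ?_⟩
  rw [Measure.map_apply (measurable_shift 0 j) hB]
  have h := hμ.pow_mul_integral_shift_le hε hW (BddMeasurable.indicator hB)
    (fun η => Set.indicator_nonneg (fun _ _ => zero_le_one) η) j
  have h1 : ∫ η, B.indicator (1 : Env d E → ℝ) (shift 0 j η) ∂μ = μ.real (shift 0 j ⁻¹' B) :=
    integral_indicator_one (measurable_shift 0 j hB)
  rw [h1, integral_indicator_one hB, measureReal_def, measureReal_def, h0, ENNReal.toReal_zero] at h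
  have h2 : (μ (shift 0 j ⁻¹' B)).toReal ≤ 0 := by
    by_contra hc
    exact absurd h (not_le.2 (mul_pos (pow_pos hε j) (not_le.1 hc)))
  exact ((ENNReal.toReal_eq_zero_iff _).1 (le_antisymm h2 ENNReal.toReal_nonneg)).resolve_right
    (measure_ne_top _ _)

/-- Since `|T h| ≤ T |h|` and `μ` is invariant, `T` contracts `L¹(μ)`. -/
lemma IsInvariant.integral_abs_trans_sub_le (hμ : W.IsInvariant μ) {f g : Env d E → ℝ}
    (hf : BddMeasurable f) (hg : BddMeasurable g) :
    ∫ η, |W.trans f η - W.trans g η| ∂μ ≤ ∫ η, |f η - g η| ∂μ := by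
  have hsub : BddMeasurable fun η => f η - g η := by
    simpa [sub_eq_add_neg] using hf.add ((BddMeasurable.const (-1)).mul hg)
  have habs : BddMeasurable fun η => |f η - g η| :=
    ⟨hsub.1.abs, hsub.2.imp fun C h η => by simpa using h η⟩
  have hT := W.bddMeasurable_trans hsub
  rw [← hμ.integral_trans habs]
  have heq : ∀ η, W.trans f η - W.trans g η = W.trans (fun η => f η - g η) η := fun η => by
    rw [W.trans_sub]
  simp_rw [heq]
  refine integral_mono (hT.integrable μ).abs ((W.bddMeasurable_trans habs).integrable μ)
    fun η => ?_
  refine (Finset.abs_sum_le_sum_abs _ _).trans (Finset.sum_le_sum fun z _ => ?_)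
  rw [abs_mul, abs_of_nonneg (W.weight_nonneg z η)]

lemma trans_indicator_eq {A : Set (Env d E)} (hA : MeasurableSet A) {η : Env d E}
    (h : W.quenched η {X | envProcess 1 (η, X) ∈ A} = A.indicator 1 η) :
    W.trans (A.indicator 1) η = A.indicator 1 η := by
  have hm : MeasurableSet {X : ℕ → Fin d → ℤ | envProcess 1 (η, X) ∈ A} :=
    ((measurable_envProcess 1).comp measurable_prodMk_left) hA
  have h1 := W.integral_quenchedLaw η 1 (BddMeasurable.indicator hA)
  rw [Function.iterate_one] at h1
  rw [← h1]
  have h2 : ∫ X, A.indicator (1 : Env d E → ℝ) (envProcess 1 (η, X)) ∂(W.quenchedLaw η) =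
      (W.quenchedLaw η).real {X | envProcess 1 (η, X) ∈ A} := integral_indicator_one hm
  rw [h2, measureReal_def]
  change (W.quenched η _).toReal = _
  rw [h]
  by_cases hη : η ∈ A <;> simp [hη]

lemma indicator_shift_ae_eq (hμ : W.IsInvariant μ) (hell : W.EllipticInTime) {ε : ℝ}
    (hε : 0 < ε) (hW : ∀ η, ε ≤ W.weight 0 η) {A : Set (Env d E)}
    (h : ∀ᵐ η ∂μ, W.trans (A.indicator 1) η = A.indicator 1 η) (j : ℕ) :
    ∀ᵐ η ∂μ, shift 0 j η ∈ A ↔ η ∈ A := by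
  induction j with
  | zero => simp
  | succ j ih =>
    filter_upwards [ih, (hμ.quasiMeasurePreserving_shift hε hW j).ae h] with η h1 h2
    rw [← h1, ← indicator_shift_eq hell h2, shift_shift]
    simp

/-- Invariant events of the environment process are approximated by events far away in the cone. -/
lemma exists_coneSigma_measure_symmDiff_le (hμ : W.IsInvariant μ) (hell : W.EllipticInTime)
    {ε : ℝ} (hε : 0 < ε) (hW : ∀ η, ε ≤ W.weight 0 η) {A : Set (Env d E)} (hA : MeasurableSet A)
    (h : ∀ᵐ η ∂μ, W.trans (A.indicator 1) η = A.indicator 1 η) (l : ℕ) {δ : ℝ} (hδ : 0 < δ) :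
    ∃ B, MeasurableSet[coneSigma d E R l] B ∧ μ (symmDiff A B) ≤ ENNReal.ofReal δ := by
  classical
  -- The shift `j` costs a factor `ε ^ (-j)`, so it must be fixed before the local approximation and
  -- cannot depend on its radius `r`. The radius is absorbed by the number `n` of steps below, which
  -- costs nothing because `T` is a contraction.
  set j : ℕ := l + d * R with hj
  have hδ' : 0 < ε ^ j * (δ / 2) := by positivity
  obtain ⟨A', hA', hlt⟩ := exists_localSets_measure_symmDiff_lt μ (S := Set.univ) (B := A)
    (by rwa [cylinderEvents_univ]) hδ'
  have hA'm := measurableSet_of_mem_localSets hA'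
  obtain ⟨Λ, -, hΛ, hdep⟩ := hA'
  obtain ⟨r, hr⟩ := exists_subset_spaceTimeBall hΛ
  have hf := BddMeasurable.indicator hA
  have hf' := BddMeasurable.indicator hA'm
  set f : Env d E → ℝ := A.indicator 1 with hfdef
  set f' : Env d E → ℝ := A'.indicator 1 with hfdef'
  have hdep' : DependsOn f' (spaceTimeBall d r) := fun η σ hησ => by
    have : (η ∈ A') = (σ ∈ A') := hdep fun p hp => hησ p (hr hp)
    simp [hfdef', Set.indicator_apply, this]
  have habs : ∀ n, ∫ η, |f η - W.trans^[n] f' η| ∂μ ≤ ε ^ j * (δ / 2) := by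
    intro n
    induction n with
    | zero =>
      have h1 : ∀ η, |f η - f' η| = (symmDiff A A').indicator 1 η := fun η => by
        by_cases h1 : η ∈ A <;> by_cases h2 : η ∈ A' <;>
          simp [hfdef, hfdef', Set.mem_symmDiff, h1, h2]
      simp only [Function.iterate_zero, id, h1]
      rw [integral_indicator_one (hA.symmDiff hA'm)]
      exact ENNReal.toReal_le_of_le_ofReal hδ'.le hlt.le
    | succ n ih =>
      refine le_trans ?_ ((hμ.integral_abs_trans_sub_le hf
        (W.bddMeasurable_trans_iterate hf' n)).trans ih)
      rw [Function.iterate_succ_apply']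
      refine (integral_congr_ae ?_).le
      filter_upwards [h] with η hη
      rw [hη]
  set n : ℕ := (R + 2) * r with hn
  set g : Env d E → ℝ := W.trans^[n] f' with hg
  have hgm : BddMeasurable g := W.bddMeasurable_trans_iterate hf' n
  have hd : BddMeasurable fun η => |f η - g η| := by
    have hsub : BddMeasurable fun η => f η - g η := by
      simpa [sub_eq_add_neg] using hf.add ((BddMeasurable.const (-1)).mul hgm)
    exact ⟨hsub.1.abs, hsub.2.imp fun C h η => by simpa using h η⟩
  have hshift : ∫ η, |f (shift 0 j η) - g (shift 0 j η)| ∂μ ≤ δ / 2 := by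
    have h1 := (hμ.pow_mul_integral_shift_le hε hW hd (fun _ => abs_nonneg _) j).trans (habs n)
    exact le_of_mul_le_mul_left h1 (pow_pos hε j)
  have hcone : DependsOn (fun η => g (shift 0 j η)) (cone d R l) := by
    refine W.dependsOn_cone_trans_iterate hdep' n (by simp; positivity) ?_ ?_ ?_ ?_
    · rw [hj]; push_cast; omega
    · rw [hn]; push_cast; omega
    · rw [hj]; push_cast; linarith [(by positivity : (0 : ℤ) ≤ d * R)]
    · rw [hj, hn]; push_cast
      linarith [(by positivity : (0 : ℤ) ≤ d * R), (by positivity : (0 : ℤ) ≤ R * r),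
        (by positivity : (0 : ℤ) ≤ r)]
  have hgs : Measurable fun η => g (shift 0 j η) := hgm.1.comp (measurable_shift 0 j)
  -- Thresholding at `1 / 2` turns the approximation of an indicator into an event; where the two
  -- disagree the error is at least `1 / 2`, so Markov's inequality turns `δ / 2` into `δ`.
  refine ⟨{η | 1 / 2 < g (shift 0 j η)},
    measurable_cylinderEvents_of_dependsOn hgs hcone measurableSet_Ioi, ?_⟩
  have hsub : ∀ᵐ η ∂μ, η ∈ symmDiff A {η | 1 / 2 < g (shift 0 j η)} →
      η ∈ {η | 1 / 2 ≤ |f (shift 0 j η) - g (shift 0 j η)|} := by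
    filter_upwards [indicator_shift_ae_eq hμ hell hε hW h j] with η hη hmem
    simp only [Set.mem_symmDiff, Set.mem_ofPred_eq, not_lt] at hmem ⊢
    rcases hmem with ⟨h1, h2⟩ | ⟨h1, h2⟩
    · rw [← hη] at h1
      simp only [hfdef, h1, Set.indicator_of_mem, Pi.one_apply]
      exact le_trans (by linarith) (le_abs_self _)
    · rw [← hη] at h2
      simp only [hfdef, h2, not_false_eq_true, Set.indicator_of_notMem, zero_sub, abs_neg]
      exact h1.le.trans (le_abs_self _)
  have hsub' : (symmDiff A {η | 1 / 2 < g (shift 0 j η)} : Set (Env d E)) ≤ᵐ[μ]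
      {η | 1 / 2 ≤ |f (shift 0 j η) - g (shift 0 j η)|} := hsub
  refine (measure_mono_ae hsub').trans ?_
  have hmarkov := mul_meas_ge_le_integral_of_nonneg (μ := μ)
    (f := fun η => |f (shift 0 j η) - g (shift 0 j η)|) (ae_of_all _ fun _ => abs_nonneg _)
    ((hd.comp (measurable_shift (E := E) (0 : Fin d → ℤ) j)).integrable μ) (1 / 2)
  rw [ENNReal.le_ofReal_iff_toReal_le (measure_ne_top _ _) hδ.le]
  rw [measureReal_def] at hmarkov
  linarith

/-- Invariant events of the environment process are tail events of the cone. -/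
lemma exists_coneTail_ae_eq (hμ : W.IsInvariant μ) (hell : W.EllipticInTime)
    {ε : ℝ} (hε : 0 < ε) (hW : ∀ η, ε ≤ W.weight 0 η) {A : Set (Env d E)} (hA : MeasurableSet A)
    (h : ∀ᵐ η ∂μ, W.trans (A.indicator 1) η = A.indicator 1 η) :
    ∃ B, MeasurableSet[coneTail d E R] B ∧ A =ᵐ[μ] B := by
  choose B hB hle using fun l : ℕ => exists_coneSigma_measure_symmDiff_le hμ hell hε hW hA h l
    (δ := (1 / 2) ^ l) (by positivity)
  -- The lower limit of the `B l` is a tail event. The errors `2 ^ (-l)` are summable, so by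
  -- Borel–Cantelli almost every `η` is eventually classified correctly.
  refine ⟨⋃ J : ℕ, ⋂ l ≥ J, B l, measurableSet_coneTail_iUnion ?_ ?_, ?_⟩
  · exact fun i j hij => Set.biInter_mono (fun l hl => le_trans hij hl) fun _ _ => subset_rfl
  · refine fun l => ⟨l, fun J hJ => MeasurableSet.iInter fun i => MeasurableSet.iInter fun hi => ?_⟩
    exact coneSigma_antitone (by exact_mod_cast hJ.trans hi) _ (hB i)
  · have hsum : ∑' l, μ (symmDiff A (B l)) ≠ ∞ := by
      refine ne_top_of_le_ne_top ?_ (ENNReal.tsum_le_tsum hle)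
      rw [← ENNReal.ofReal_tsum_of_nonneg (fun l => by positivity) summable_geometric_two]
      exact ENNReal.ofReal_ne_top
    filter_upwards [ae_eventually_notMem hsum] with η hη
    obtain ⟨J, hJ⟩ := eventually_atTop.1 hη
    have hiff : ∀ l ≥ J, (η ∈ A ↔ η ∈ B l) := fun l hl => by
      have := hJ l hl
      rw [Set.mem_symmDiff] at this
      tauto
    refine propext ⟨fun hηA => ?_, fun hηB => ?_⟩
    · exact Set.mem_iUnion.2 ⟨J, Set.mem_iInter₂.2 fun l hl => (hiff l hl).1 hηA⟩
    · obtain ⟨J', hJ'⟩ := Set.mem_iUnion.1 hηB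
      exact (hiff _ (le_max_left J J')).2 (Set.mem_iInter₂.1 hJ' _ (le_max_right J J'))

theorem IsInvariant.isErgodic (hμ : W.IsInvariant μ) (hell : W.EllipticInTime)
    {ε : ℝ} (hε : 0 < ε) (hW : ∀ η, ε ≤ W.weight 0 η) {P : Measure (Env d E)}
    [IsProbabilityMeasure P] (hP : TranslationInvariant P) (herg : ErgodicInTime P)
    (htail : ∀ B, MeasurableSet[coneTail d E R] B → μ B = P B) : W.IsErgodic μ := by
  refine ⟨hμ, fun A hA hinv => ?_⟩
  have h : ∀ᵐ η ∂μ, W.trans (A.indicator 1) η = A.indicator 1 η := by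
    filter_upwards [hinv] with η hη using trans_indicator_eq hA hη
  obtain ⟨B, hB, hAB⟩ := exists_coneTail_ae_eq hμ hell hε hW hA h
  have hBs := measurableSet_coneTail_preimage_shift hB
  have hq := hμ.quasiMeasurePreserving_shift hε hW 1
  have hshift : shift 0 1 ⁻¹' B =ᵐ[μ] B := by
    have h1 : shift 0 1 ⁻¹' A =ᵐ[μ] shift 0 1 ⁻¹' B := by
      simpa using hq.preimage_ae_eq hAB
    have h2 : shift 0 1 ⁻¹' A =ᵐ[μ] A := by
      filter_upwards [indicator_shift_ae_eq hμ hell hε hW h 1] with η hη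
      have hη' : shift 0 1 η ∈ A ↔ η ∈ A := by simpa using hη
      exact propext hη'
    exact h1.symm.trans (h2.trans hAB)
  -- `B` and its preimage are both tail events, hence so is their symmetric difference, on which `μ`
  -- and `P` agree.
  have hshiftP : shift 0 1 ⁻¹' B =ᵐ[P] B := by
    rw [← measure_symmDiff_eq_zero_iff] at hshift ⊢
    rw [← htail _ (hBs.symmDiff hB)]
    exact hshift
  have hqe : QuasiErgodic (shift (E := E) (0 : Fin d → ℤ) 1) P :=
    { herg.preErgodic, (hP.measurePreserving 0 1).quasiMeasurePreserving with }
  rw [measure_congr hAB, htail B hB]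
  rcases hqe.ae_empty_or_univ₀ (measurableSet_of_coneTail hB).nullMeasurableSet hshiftP with h0 | h1
  · exact Or.inl (by rw [measure_congr h0, measure_empty])
  · exact Or.inr (by rw [measure_congr h1, measure_univ])

end Walk

end RWRE

/-! ### The mean ergodic theorem for the environment process. -/

namespace RWRE

variable {d : ℕ} {E : Type*} {R : ℕ}

/-- The averages of the expectations of `f` along the environment process. -/
def Walk.average (W : Walk d E R) (f : Env d E → ℝ) (t : ℕ) (η : Env d E) : ℝ :=
  (t : ℝ)⁻¹ * ∑ s ∈ Finset.range t, W.trans^[s] f η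

lemma Walk.abs_average_le (W : Walk d E R) {f : Env d E → ℝ} {C : ℝ} (hC : ∀ η, |f η| ≤ C)
    (t : ℕ) (η : Env d E) : |W.average f t η| ≤ C := by
  rcases Nat.eq_zero_or_pos t with rfl | ht
  · simpa [average] using (abs_nonneg _).trans (hC η)
  · have hpos : (0 : ℝ) < t := by exact_mod_cast ht
    rw [average, abs_mul, abs_of_pos (inv_pos.2 hpos), inv_mul_le_iff₀ hpos]
    refine (Finset.abs_sum_le_sum_abs _ _).trans ?_
    simpa using Finset.sum_le_card_nsmul (Finset.range t) _ C
      fun s _ => W.abs_trans_iterate_le hC s η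

lemma BddMeasurable.memLp {Ω : Type*} [MeasurableSpace Ω] {f : Ω → ℝ} (hf : BddMeasurable f)
    (μ : Measure Ω) [IsFiniteMeasure μ] (p : ℝ≥0∞) : MemLp f p μ := by
  obtain ⟨hm, C, hC⟩ := hf
  exact MemLp.of_bound hm.aestronglyMeasurable C (ae_of_all _ fun x => by simpa using hC x)

variable [MeasurableSpace E] [Finite E] [MeasurableSingletonClass E]

namespace Walk

variable {W : Walk d E R}

lemma bddMeasurable_average (W : Walk d E R) {f : Env d E → ℝ} (hf : BddMeasurable f) (t : ℕ) :
    BddMeasurable (W.average f t) :=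
  (BddMeasurable.const _).mul (BddMeasurable.sum _ fun s _ => W.bddMeasurable_trans_iterate hf s)

lemma integral_average (W : Walk d E R) (Q : Measure (Env d E)) [IsProbabilityMeasure Q]
    {f : Env d E → ℝ} (hf : BddMeasurable f) (t : ℕ) :
    ∫ η, W.average f t η ∂Q = ∫ η, f η ∂(W.cesaro Q t) := by
  rw [W.integral_cesaro Q t hf]
  simp only [average]
  rw [integral_const_mul,
    integral_finsetSum _ fun s _ => (W.bddMeasurable_trans_iterate hf s).integrable Q]

lemma IsInvariant.measurePreserving_envProcess {μ : Measure (Env d E)}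
    (hμ : W.IsInvariant μ) (t : ℕ) :
    MeasurePreserving (envProcess t) (W.jointLaw μ) μ :=
  ⟨measurable_envProcess t, hμ t⟩

variable {μ : Measure (Env d E)} [IsProbabilityMeasure μ]

instance (W : Walk d E R) : IsProbabilityMeasure (W.jointLaw μ) := by
  unfold jointLaw; infer_instance

lemma measurePreserving_fst_jointLaw (W : Walk d E R) (μ : Measure (Env d E))
    [IsProbabilityMeasure μ] : MeasurePreserving Prod.fst (W.jointLaw μ) μ :=
  ⟨measurable_fst, Measure.fst_compProd μ W.quenched⟩

/-- The isometry `g ↦ g(η₀^EP)` from `L²(μ)` to `L²(P_μ)`. -/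
def presentLp (W : Walk d E R) (μ : Measure (Env d E)) [IsProbabilityMeasure μ] :
    Lp ℝ 2 μ →ₗᵢ[ℝ] Lp ℝ 2 (W.jointLaw μ) :=
  Lp.compMeasurePreservingₗᵢ ℝ Prod.fst (W.measurePreserving_fst_jointLaw μ)

/-- The isometry `g ↦ g(η₁^EP)` from `L²(μ)` to `L²(P_μ)`, for invariant `μ`. -/
def futureLp (hμ : W.IsInvariant μ) : Lp ℝ 2 μ →ₗᵢ[ℝ] Lp ℝ 2 (W.jointLaw μ) :=
  Lp.compMeasurePreservingₗᵢ ℝ (envProcess 1) (hμ.measurePreserving_envProcess 1)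

lemma presentLp_ae_eq (g : Lp ℝ 2 μ) :
    ∀ᵐ p ∂(W.jointLaw μ), W.presentLp μ g p = g p.1 :=
  Lp.coeFn_compMeasurePreserving g (W.measurePreserving_fst_jointLaw μ)

lemma futureLp_ae_eq {μ : Measure (Env d E)} [IsProbabilityMeasure μ] (hμ : W.IsInvariant μ)
    (g : Lp ℝ 2 μ) :
    ∀ᵐ p ∂(W.jointLaw μ), futureLp hμ g p = g (envProcess 1 p) :=
  Lp.coeFn_compMeasurePreserving g (hμ.measurePreserving_envProcess 1)

/-- The transition operator of the environment process on `L²(μ)`. -/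
def transLp (hμ : W.IsInvariant μ) : Lp ℝ 2 μ →L[ℝ] Lp ℝ 2 μ :=
  (W.presentLp μ).toContinuousLinearMap.adjoint ∘L (futureLp hμ).toContinuousLinearMap

/-- The adjoint of the present isometry is conditional expectation given `η₀^EP`, so `transLp` is `f
↦ E[f(η₁^EP) | η₀^EP]`; as a product of contractions it is a contraction. -/
lemma inner_transLp (hμ : W.IsInvariant μ) (g f : Lp ℝ 2 μ) :
    inner ℝ g (transLp hμ f) = inner ℝ (W.presentLp μ g) (futureLp hμ f) := by
  simp [transLp, ContinuousLinearMap.adjoint_inner_right]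

lemma norm_transLp_le (hμ : W.IsInvariant μ) : ‖transLp hμ‖ ≤ 1 := by
  refine (ContinuousLinearMap.opNorm_comp_le _ _).trans ?_
  rw [LinearIsometryEquiv.norm_map]
  exact mul_le_one₀ (W.presentLp μ).norm_toContinuousLinearMap_le (norm_nonneg _)
    (futureLp hμ).norm_toContinuousLinearMap_le

lemma transLp_toLp (hμ : W.IsInvariant μ) {f : Env d E → ℝ} (hf : BddMeasurable f) :
    transLp hμ ((hf.memLp μ 2).toLp f) = ((W.bddMeasurable_trans hf).memLp μ 2).toLp _ := by
  refine ext_inner_left ℝ fun g => ?_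
  rw [inner_transLp, L2.inner_def, L2.inner_def]
  have hpre := presentLp_ae_eq (W := W) g
  have hfut := futureLp_ae_eq hμ ((hf.memLp μ 2).toLp f)
  have hf' := (hμ.measurePreserving_envProcess 1).quasiMeasurePreserving.ae
    (hf.memLp μ 2).coeFn_toLp
  have heq : (fun p => inner ℝ (W.presentLp μ g p) (futureLp hμ ((hf.memLp μ 2).toLp f) p))
      =ᵐ[W.jointLaw μ] fun p => g p.1 * f (envProcess 1 p) := by
    filter_upwards [hpre, hfut, hf'] with p h1 h2 h3
    rw [h1, h2, h3]
    simp [mul_comm]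
  have hint := (integrable_congr heq).1 (L2.integrable_inner _ _)
  rw [integral_congr_ae heq]
  unfold jointLaw at hint ⊢
  rw [Measure.integral_compProd hint]
  refine integral_congr_ae ?_
  filter_upwards [((W.bddMeasurable_trans hf).memLp μ 2).coeFn_toLp] with η hη
  rw [hη, integral_const_mul]
  have := W.integral_quenchedLaw η 1 hf
  rw [Function.iterate_one] at this
  change _ * ∫ X, f (envProcess 1 (η, X)) ∂(W.quenchedLaw η) = _
  rw [this]
  simp [mul_comm]

lemma transLp_iterate_toLp (hμ : W.IsInvariant μ) {f : Env d E → ℝ} (hf : BddMeasurable f)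
    (n : ℕ) : (transLp hμ)^[n] ((hf.memLp μ 2).toLp f) =
      ((W.bddMeasurable_trans_iterate hf n).memLp μ 2).toLp _ := by
  induction n with
  | zero => rfl
  | succ n ih =>
    rw [Function.iterate_succ_apply', ih, transLp_toLp hμ (W.bddMeasurable_trans_iterate hf n)]
    congr 1
    rw [Function.iterate_succ_apply']

lemma birkhoffAverage_transLp_ae_eq (hμ : W.IsInvariant μ) {f : Env d E → ℝ}
    (hf : BddMeasurable f) (t : ℕ) :
    (birkhoffAverage ℝ (transLp hμ) id t ((hf.memLp μ 2).toLp f) : Lp ℝ 2 μ)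
      =ᵐ[μ] W.average f t := by
  have h1 : ∀ᵐ η ∂μ, ∀ s : ℕ, (transLp hμ)^[s] ((hf.memLp μ 2).toLp f) η = W.trans^[s] f η := by
    refine ae_all_iff.2 fun s => ?_
    rw [transLp_iterate_toLp hμ hf s]
    exact MemLp.coeFn_toLp _
  have h2 := Lp.coeFn_smul ((t : ℝ)⁻¹)
    (∑ s ∈ Finset.range t, (transLp hμ)^[s] ((hf.memLp μ 2).toLp f))
  have h3 := Lp.coeFn_finsetSum (Finset.range t)
    fun s => (transLp hμ)^[s] ((hf.memLp μ 2).toLp f)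
  filter_upwards [h1, h2, h3] with η h1 h2 h3
  simp only [birkhoffAverage, birkhoffSum, id, average]
  rw [h2, Pi.smul_apply, h3, Finset.sum_apply]
  simp [h1]

/-- For ergodic `μ`, the invariant functions of the transition operator are constant. -/
lemma IsErgodic.ae_eq_const_of_transLp_eq (hμ : W.IsErgodic μ) {g : Lp ℝ 2 μ}
    (hg : transLp hμ.1 g = g) : ∃ c : ℝ, g =ᵐ[μ] fun _ => c := by
  -- Equality case of Cauchy–Schwarz: the squared distance is `2‖g‖² - 2⟪g, T g⟫ = 0`. Thus `g` does
  -- not change along the process, and all its level sets are invariant events.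
  have heq : W.presentLp μ g = futureLp hμ.1 g := by
    have h1 : inner ℝ (W.presentLp μ g) (futureLp hμ.1 g) = ‖g‖ ^ 2 := by
      rw [← inner_transLp, hg, real_inner_self_eq_norm_sq]
    have h2 := norm_sub_sq_real (W.presentLp μ g) (futureLp hμ.1 g)
    rw [h1, LinearIsometry.norm_map, LinearIsometry.norm_map] at h2
    have h3 : ‖W.presentLp μ g - futureLp hμ.1 g‖ ^ 2 = 0 := by rw [h2]; ring
    exact sub_eq_zero.1 (norm_eq_zero.1 (pow_eq_zero_iff two_ne_zero |>.1 h3))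
  have hae : ∀ᵐ p ∂(μ ⊗ₘ W.quenched), g (envProcess 1 p) = g p.1 := by
    have h1 := presentLp_ae_eq (W := W) g
    have h2 := futureLp_ae_eq hμ.1 g
    unfold jointLaw at h1 h2
    filter_upwards [h1, h2] with p h1 h2
    rw [← h1, ← h2]
    exact congrArg (fun h : Lp ℝ 2 (W.jointLaw μ) => h p) heq.symm
  have hae' := Measure.ae_ae_of_ae_compProd hae
  refine exists_eventuallyEq_const_of_forall_separating MeasurableSet fun U hU => ?_
  have hA : MeasurableSet (g ⁻¹' U) := (Lp.stronglyMeasurable g).measurable hU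
  have h01 := hμ.2 (g ⁻¹' U) hA ?_
  · rcases h01 with h0 | h1
    · exact Or.inr (measure_eq_zero_iff_ae_notMem.1 h0)
    · exact Or.inl ((prob_compl_eq_zero_iff hA).2 h1)
  · filter_upwards [hae'] with η hη
    by_cases hmem : g η ∈ U
    · rw [Set.indicator_of_mem (show η ∈ g ⁻¹' U from hmem), Pi.one_apply]
      have huniv : {X | envProcess 1 (η, X) ∈ g ⁻¹' U} =ᵐ[W.quenched η] Set.univ := by
        refine eventuallyEq_univ.2 ?_
        filter_upwards [hη] with X hX
        change g (envProcess 1 (η, X)) ∈ U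
        rwa [hX]
      rw [measure_congr huniv, measure_univ]
    · rw [Set.indicator_of_notMem (show η ∉ g ⁻¹' U from hmem)]
      refine measure_eq_zero_iff_ae_notMem.2 ?_
      filter_upwards [hη] with X hX hc
      exact hmem (hX ▸ hc)

/-- Mean ergodic theorem for the environment process, along subsequences. -/
theorem IsErgodic.exists_subseq_tendsto_average (hμ : W.IsErgodic μ) {f : Env d E → ℝ}
    (hf : BddMeasurable f) {ns : ℕ → ℕ} (hns : Tendsto ns atTop atTop) :
    ∃ ms : ℕ → ℕ, StrictMono ms ∧
      ∀ᵐ η ∂μ, Tendsto (fun k => W.average f (ns (ms k)) η) atTop (𝓝 (∫ η, f η ∂μ)) := by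
  have hlim := (transLp hμ.1).tendsto_birkhoffAverage_orthogonalProjection
    (norm_transLp_le hμ.1) ((hf.memLp μ 2).toLp f)
  set q := ((transLp hμ.1).eqLocus (1 : Lp ℝ 2 μ →L[ℝ] Lp ℝ 2 μ)).orthogonalProjectionOnto
    ((hf.memLp μ 2).toLp f) with hq
  obtain ⟨c, hc⟩ := hμ.ae_eq_const_of_transLp_eq (g := q) q.2
  obtain ⟨ms, hms, hae⟩ := (tendstoInMeasure_of_tendsto_Lp (hlim.comp hns)).exists_seq_tendsto_ae
  have hav : ∀ᵐ η ∂μ, ∀ t,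
      (birkhoffAverage ℝ (transLp hμ.1) id t ((hf.memLp μ 2).toLp f) : Lp ℝ 2 μ) η =
        W.average f t η :=
    ae_all_iff.2 fun t => birkhoffAverage_transLp_ae_eq hμ.1 hf t
  have hconv : ∀ᵐ η ∂μ, Tendsto (fun k => W.average f (ns (ms k)) η) atTop (𝓝 c) := by
    filter_upwards [hae, hav, hc] with η h1 h2 h3
    simp only [Function.comp_apply, h2, h3] at h1
    exact h1
  refine ⟨ms, hms, ?_⟩
  obtain ⟨C, hC⟩ := hf.2
  have hint : Tendsto (fun k => ∫ η, W.average f (ns (ms k)) η ∂μ) atTop (𝓝 (∫ _, c ∂μ)) :=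
    tendsto_integral_of_dominated_convergence (fun _ => C)
      (fun k => (W.bddMeasurable_average hf _).1.aestronglyMeasurable) (integrable_const C)
      (fun k => ae_of_all _ (W.abs_average_le hC _)) hconv
  -- Invariance keeps the integral of the averages fixed, which identifies `c`; the empty average at
  -- time `0` has to be excluded.
  have hev : ∀ᶠ k in atTop, ∫ η, W.average f (ns (ms k)) η ∂μ = ∫ η, f η ∂μ := by
    filter_upwards [(hns.comp hms.tendsto_atTop).eventually_gt_atTop 0] with k hk
    have hk' : ((ns (ms k) : ℕ) : ℝ) ≠ 0 := by exact_mod_cast hk.ne'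
    rw [W.integral_average μ hf, W.integral_cesaro μ _ hf]
    simp_rw [← W.integral_envLaw μ _ hf, hμ.1 _]
    simp [hk']
  have hc' : ∫ η, f η ∂μ = c := by
    have := tendsto_nhds_unique (tendsto_const_nhds.congr' (EventuallyEq.symm hev)) hint
    simpa using this
  rwa [hc']

end Walk

end RWRE

/-! ### Transfer of the ergodic averages to `Q` and weak convergence. -/

namespace RWRE

variable {d : ℕ} {E : Type*} {R : ℕ}

/-- Continuous functions are uniformly approximated by functions of finitely many coordinates. -/
lemma exists_dependsOn_spaceTimeBall_abs_sub_le [Finite E] [TopologicalSpace E]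
    [DiscreteTopology E] {f : Env d E → ℝ} (hf : Continuous f) {δ : ℝ} (hδ : 0 < δ) :
    ∃ (r : ℕ) (e : Env d E → Env d E), DependsOn (fun η => f (e η)) (spaceTimeBall d r) ∧
      ∀ η, |f η - f (e η)| ≤ δ := by
  classical
  rcases isEmpty_or_nonempty (Env d E) with hE | ⟨⟨η₀⟩⟩
  · exact ⟨0, id, fun η => hE.elim η, fun η => hE.elim η⟩
  have hloc : ∀ a : Env d E, ∃ I : Finset (SpaceTime d),
      ∀ η : Env d E, (∀ p ∈ I, η p = a p) → |f η - f a| < δ / 2 := by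
    intro a
    have hopen : IsOpen {η | |f η - f a| < δ / 2} :=
      isOpen_lt (by fun_prop) continuous_const
    obtain ⟨I, u, hu, hsub⟩ := isOpen_pi_iff.1 hopen a (by simpa using hδ)
    exact ⟨I, fun η hη => hsub fun p hp => by rw [hη p hp]; exact (hu p hp).2⟩
  choose I hI using hloc
  -- Finitely many cylinders suffice, and all their coordinates lie in one ball; resetting
  -- coordinates outside it keeps `η` in its cylinder, where `f` is within `δ / 2` of its value at
  -- the centre.
  obtain ⟨s, -, hs⟩ := isCompact_univ.elim_nhds_subcover
    (fun a : Env d E => {η | ∀ p ∈ I a, η p = a p}) fun a _ => by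
      have : {η : Env d E | ∀ p ∈ I a, η p = a p} =
          (I a : Set (SpaceTime d)).pi fun p => {a p} := by
        ext η; simp
      rw [this]
      exact (isOpen_set_pi (I a).finite_toSet fun p _ => isOpen_discrete _).mem_nhds (by simp)
  obtain ⟨r, hr⟩ := exists_subset_spaceTimeBall (s.biUnion I).finite_toSet
  let e : Env d E → Env d E := fun η p => if p ∈ spaceTimeBall d r then η p else η₀ p
  refine ⟨r, e, fun η σ h => ?_, fun η => ?_⟩
  · refine congrArg f (funext fun p => ?_)
    by_cases hp : p ∈ spaceTimeBall d r
    · simp [e, hp, h p hp]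
    · simp [e, hp]
  · obtain ⟨a, has, ha⟩ := Set.mem_iUnion₂.1 (hs (Set.mem_univ η))
    have h1 := hI a η ha
    have h2 := hI a (e η) fun p hp => by
      have : p ∈ spaceTimeBall d r := hr (by
        simp only [Finset.coe_biUnion, Set.mem_iUnion]
        exact ⟨a, has, hp⟩)
      simp only [e, this, if_true]
      exact ha p hp
    rw [abs_lt] at h1 h2
    rw [abs_le]
    constructor <;> linarith [h1.1, h1.2, h2.1, h2.2]

namespace Walk

variable (W : Walk d E R)

lemma trans_average (f : Env d E → ℝ) (t : ℕ) (η : Env d E) :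
    W.trans (W.average f t) η = (t : ℝ)⁻¹ * ∑ s ∈ Finset.range t, W.trans^[s + 1] f η := by
  simp_rw [Function.iterate_succ_apply', trans, average, Finset.mul_sum]
  rw [Finset.sum_comm]
  exact Finset.sum_congr rfl fun s _ => Finset.sum_congr rfl fun z _ => by ring

lemma abs_trans_average_sub_le {f : Env d E → ℝ} {C : ℝ} (hC : ∀ η, |f η| ≤ C) (t : ℕ)
    (η : Env d E) : |W.trans (W.average f t) η - W.average f t η| ≤ (t : ℝ)⁻¹ * (2 * C) := by
  rw [W.trans_average, average, ← mul_sub, ← Finset.sum_sub_distrib,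
    Finset.sum_range_sub (fun n => W.trans^[n] f η), abs_mul,
    abs_of_nonneg (by positivity : (0 : ℝ) ≤ (t : ℝ)⁻¹)]
  refine mul_le_mul_of_nonneg_left ?_ (by positivity)
  have h1 := abs_le.1 (W.abs_trans_iterate_le hC t η)
  have h2 := abs_le.1 (W.abs_trans_iterate_le hC 0 η)
  rw [abs_le]
  constructor <;> linarith [h1.1, h1.2, h2.1, h2.2]

lemma abs_trans_iterate_average_sub_le {f : Env d E → ℝ} {C : ℝ} (hC : ∀ η, |f η| ≤ C)
    (t J : ℕ) (η : Env d E) :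
    |W.trans^[J] (W.average f t) η - W.average f t η| ≤ J * ((t : ℝ)⁻¹ * (2 * C)) := by
  induction J with
  | zero => simp
  | succ J ih =>
    have h1 := W.abs_trans_iterate_le (W.abs_trans_average_sub_le hC t) J η
    rw [W.trans_iterate_sub] at h1
    rw [Function.iterate_succ_apply]
    have h2 := abs_sub_le (W.trans^[J] (W.trans (W.average f t)) η)
      (W.trans^[J] (W.average f t) η) (W.average f t η)
    push_cast
    linarith

/-- `T^J` is a finite weighted average over positions reachable in `J` steps, all of norm at most `R
* J`. -/
lemma tendsto_trans_iterate {g : ℕ → Env d E → ℝ} {c : ℝ} (J : ℕ) {η : Env d E}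
    (h : ∀ x : Fin d → ℤ, normOne x ≤ R * J →
      Tendsto (fun k => g k (shift x J η)) atTop (𝓝 c)) :
    Tendsto (fun k => W.trans^[J] (g k) η) atTop (𝓝 c) := by
  induction J generalizing η with
  | zero => simpa using h 0 (by simp)
  | succ J ih =>
    simp_rw [Function.iterate_succ_apply', trans]
    have hc : c = ∑ z ∈ ball d R, W.weight z η * c := by
      rw [← Finset.sum_mul, W.sum_weight, one_mul]
    rw [hc]
    refine tendsto_finsetSum _ fun z hz => Tendsto.const_mul _ (ih fun x hx => ?_)
    have hle : normOne (z + x) ≤ R * ((J + 1 : ℕ) : ℤ) := by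
      have h1 := normOne_add z x
      have h2 := mem_ball.1 hz
      push_cast
      linarith
    simpa [shift_shift, add_comm (1 : ℤ)] using h (z + x) hle

/-- If the averages converge from all points of the cone at some time, then they converge from the
origin. -/
lemma tendsto_average {f : Env d E → ℝ} {C : ℝ} (hC : ∀ η, |f η| ≤ C) {ts : ℕ → ℕ}
    (hts : Tendsto ts atTop atTop) {c : ℝ} {J : ℕ} {η : Env d E}
    (h : ∀ x : Fin d → ℤ, normOne x ≤ R * J →
      Tendsto (fun k => W.average f (ts k) (shift x J η)) atTop (𝓝 c)) :
    Tendsto (fun k => W.average f (ts k) η) atTop (𝓝 c) := by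
  have h1 := W.tendsto_trans_iterate J h
  have h2 : Tendsto (fun k => (J : ℝ) * (((ts k : ℕ) : ℝ)⁻¹ * (2 * C))) atTop (𝓝 0) := by
    have := ((((tendsto_natCast_atTop_atTop (R := ℝ)).comp hts).inv_tendsto_atTop).mul_const
      (2 * C)).const_mul (J : ℝ)
    simpa using this
  have h3 : Tendsto (fun k => W.trans^[J] (W.average f (ts k)) η - W.average f (ts k) η) atTop
      (𝓝 0) := squeeze_zero_norm (fun k => W.abs_trans_iterate_average_sub_le hC (ts k) J η) h2
  simpa using h1.sub h3

/-- The average includes `s = 0`, so here the starting time `j` alone has to absorb the radius of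
`f`. -/
lemma dependsOn_cone_average {f : Env d E → ℝ} {r : ℕ} (hf : DependsOn f (spaceTimeBall d r))
    (t : ℕ) {x : Fin d → ℤ} {j l : ℕ} (hx : normOne x ≤ R * j)
    (hj : l + d * R + (R + 2) * r ≤ j) :
    DependsOn (fun η => W.average f t (shift x j η)) (cone d R l) := by
  intro η σ h
  simp only [average]
  congr 1
  refine Finset.sum_congr rfl fun s _ => ?_
  have hj' : (l + d * R + (R + 2) * r : ℤ) ≤ j := by exact_mod_cast hj
  have h1 : (0 : ℤ) ≤ R * r := by positivity
  have h2 : (0 : ℤ) ≤ d * R := by positivity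
  exact W.dependsOn_cone_trans_iterate hf s hx (by linarith) (by linarith) (by linarith)
    (by linarith) h

/-- The event that the averages converge from all points of `X j` at all times `j ≥ J`. -/
def convergenceSet (f : Env d E → ℝ) (ts : ℕ → ℕ) (c : ℝ) (X : ℕ → Set (Fin d → ℤ)) (J : ℕ) :
    Set (Env d E) :=
  ⋂ j ≥ J, ⋂ x ∈ X j,
    {η | Tendsto (fun k => W.average f (ts k) (shift x (j : ℤ) η)) atTop (𝓝 c)}

lemma monotone_convergenceSet (f : Env d E → ℝ) (ts : ℕ → ℕ) (c : ℝ)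
    (X : ℕ → Set (Fin d → ℤ)) : Monotone (W.convergenceSet f ts c X) :=
  fun _ _ hij => Set.biInter_mono (fun _ hl => le_trans hij hl) fun _ _ => subset_rfl

variable [MeasurableSpace E] [Finite E] [MeasurableSingletonClass E]

lemma measurableSet_iUnion_convergenceSet {f : Env d E → ℝ} (hfm : BddMeasurable f) {r : ℕ}
    (hf : DependsOn f (spaceTimeBall d r)) (ts : ℕ → ℕ) (c : ℝ) {X : ℕ → Set (Fin d → ℤ)}
    (hX : ∀ j, ∀ x ∈ X j, normOne x ≤ R * j) :
    MeasurableSet[coneTail d E R] (⋃ J, W.convergenceSet f ts c X J) := by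
  refine measurableSet_coneTail_iUnion (W.monotone_convergenceSet f ts c X)
    fun l => ⟨l + d * R + (R + 2) * r, fun J hJ => ?_⟩
  refine MeasurableSet.iInter fun j => MeasurableSet.iInter fun hj =>
    MeasurableSet.iInter fun x => MeasurableSet.iInter fun hx => ?_
  refine measurableSet_cylinderEvents_of_dependsOn ?_ fun η σ h => ?_
  · exact measurableSet_tendsto _ fun k =>
      (W.bddMeasurable_average hfm (ts k)).1.comp (measurable_shift x j)
  · have : ∀ k, W.average f (ts k) (shift x j η) = W.average f (ts k) (shift x j σ) :=
      fun k => W.dependsOn_cone_average hf (ts k) (hX j x hx) (hJ.trans hj) h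
    simp [this]

variable {W} {μ P Q : Measure (Env d E)} [IsProbabilityMeasure μ] [IsProbabilityMeasure P]

/-- Two tail events are needed. Nonsingularity of `μ` is available only for time shifts, so the
passage from `μ` to `P` uses the points `(o, j)`. Since `P` is invariant under all shifts,
convergence then holds from every point, and the passage from `P` to `Q` uses every position the
walk can reach. -/
lemma IsErgodic.exists_subseq_tendsto_average_of_absolutelyContinuous (hμ : W.IsErgodic μ)
    {ε : ℝ} (hε : 0 < ε) (hW : ∀ η, ε ≤ W.weight 0 η) (hP : TranslationInvariant P)
    (htail : ∀ B, MeasurableSet[coneTail d E R] B → μ B = P B)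
    (hQ : ∀ B, MeasurableSet[coneTail d E R] B → P B = 0 → Q B = 0)
    {f : Env d E → ℝ} (hfm : BddMeasurable f) {r : ℕ} (hf : DependsOn f (spaceTimeBall d r))
    {ns : ℕ → ℕ} (hns : Tendsto ns atTop atTop) :
    ∃ ms : ℕ → ℕ, ∀ᵐ η ∂Q,
      Tendsto (fun k => W.average f (ns (ms k)) η) atTop (𝓝 (∫ η, f η ∂μ)) := by
  obtain ⟨ms, hms, hae⟩ := hμ.exists_subseq_tendsto_average hfm hns
  refine ⟨ms, ?_⟩
  set c := ∫ η, f η ∂μ with hc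
  set ts : ℕ → ℕ := fun k => ns (ms k) with hts
  set G : Set (Env d E) := {η | Tendsto (fun k => W.average f (ts k) η) atTop (𝓝 c)} with hG
  have hGm : MeasurableSet G :=
    measurableSet_tendsto _ fun k => (W.bddMeasurable_average hfm (ts k)).1
  have hμG : ∀ᵐ η ∂μ, ∀ j : ℕ, shift 0 j η ∈ G :=
    ae_all_iff.2 fun j => (hμ.1.quasiMeasurePreserving_shift hε hW j).ae hae
  have hX₀ : ∀ j : ℕ, ∀ x ∈ ({0} : Set (Fin d → ℤ)), normOne x ≤ R * j := by
    rintro j x rfl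
    simp only [normOne_zero]
    positivity
  have htail₀ := W.measurableSet_iUnion_convergenceSet hfm hf ts c hX₀
  have hP₀ : P (⋃ J, W.convergenceSet f ts c (fun _ => {0}) J) = 1 := by
    rw [← htail _ htail₀, ← prob_compl_eq_zero_iff (measurableSet_of_coneTail htail₀)]
    refine measure_eq_zero_iff_ae_notMem.2 ?_
    filter_upwards [hμG] with η hη hmem
    refine hmem (Set.mem_iUnion.2 ⟨0, Set.mem_iInter₂.2 fun j _ => Set.mem_iInter₂.2 ?_⟩)
    rintro x rfl
    exact hη j
  -- The convergence sets increase to an event of probability one, and the `J`-th is contained in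
  -- `θ_{o,J}⁻¹ G`, which has probability `P G` by stationarity.
  have hPG : P G = 1 := by
    refine le_antisymm prob_le_one ?_
    rw [← hP₀, (W.monotone_convergenceSet f ts c fun _ => {0}).measure_iUnion]
    refine iSup_le fun J => ?_
    rw [← (hP.measurePreserving 0 (J : ℤ)).measure_preimage hGm.nullMeasurableSet]
    refine measure_mono fun η hη => ?_
    exact Set.mem_iInter₂.1 (Set.mem_iInter₂.1 hη J le_rfl) 0 rfl
  have hPae : ∀ᵐ η ∂P, η ∈ G := (prob_compl_eq_zero_iff hGm).2 hPG
  have hPall : ∀ᵐ η ∂P, ∀ (x : Fin d → ℤ) (j : ℕ), shift x j η ∈ G :=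
    ae_all_iff.2 fun x => ae_all_iff.2 fun j =>
      (hP.measurePreserving x j).quasiMeasurePreserving.ae hPae
  let X : ℕ → Set (Fin d → ℤ) := fun j => {x | normOne x ≤ R * j}
  have htail₁ := W.measurableSet_iUnion_convergenceSet hfm hf ts c (X := X) fun j x hx => hx
  have hQ₁ := hQ _ htail₁.compl (measure_eq_zero_iff_ae_notMem.2 (by
    filter_upwards [hPall] with η hη hmem
    exact hmem (Set.mem_iUnion.2 ⟨0, Set.mem_iInter₂.2 fun j _ =>
      Set.mem_iInter₂.2 fun x _ => hη x j⟩)))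
  obtain ⟨C, hC⟩ := hfm.2
  filter_upwards [measure_eq_zero_iff_ae_notMem.1 hQ₁] with η hη
  obtain ⟨J, hJ⟩ := Set.mem_iUnion.1 (not_not.1 hη)
  exact W.tendsto_average hC (hns.comp hms.tendsto_atTop) fun x hx =>
    Set.mem_iInter₂.1 (Set.mem_iInter₂.1 hJ J le_rfl) x hx

variable [IsProbabilityMeasure Q]

lemma IsErgodic.tendsto_integral_cesaro_of_dependsOn (hμ : W.IsErgodic μ)
    {ε : ℝ} (hε : 0 < ε) (hW : ∀ η, ε ≤ W.weight 0 η) (hP : TranslationInvariant P)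
    (htail : ∀ B, MeasurableSet[coneTail d E R] B → μ B = P B)
    (hQ : ∀ B, MeasurableSet[coneTail d E R] B → P B = 0 → Q B = 0)
    {f : Env d E → ℝ} (hfm : BddMeasurable f) {r : ℕ} (hf : DependsOn f (spaceTimeBall d r)) :
    Tendsto (fun t => ∫ η, f η ∂(W.cesaro Q t)) atTop (𝓝 (∫ η, f η ∂μ)) := by
  refine tendsto_of_subseq_tendsto fun ns hns => ?_
  obtain ⟨ms, hms⟩ := hμ.exists_subseq_tendsto_average_of_absolutelyContinuous hε hW hP htail hQ
    hfm hf hns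
  obtain ⟨C, hC⟩ := hfm.2
  refine ⟨ms, ?_⟩
  simp_rw [← W.integral_average Q hfm]
  have := tendsto_integral_of_dominated_convergence (μ := Q) (fun _ => C)
    (fun k => (W.bddMeasurable_average hfm (ns (ms k))).1.aestronglyMeasurable)
    (integrable_const C) (fun k => ae_of_all _ (W.abs_average_le hC _)) hms
  simpa using this

theorem IsErgodic.tendsto_integral_cesaro [TopologicalSpace E] [DiscreteTopology E]
    (hμ : W.IsErgodic μ) {ε : ℝ} (hε : 0 < ε) (hW : ∀ η, ε ≤ W.weight 0 η)
    (hP : TranslationInvariant P) (htail : ∀ B, MeasurableSet[coneTail d E R] B → μ B = P B)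
    (hQ : ∀ B, MeasurableSet[coneTail d E R] B → P B = 0 → Q B = 0) (f : Env d E →ᵇ ℝ) :
    Tendsto (fun t => ∫ η, f η ∂(W.cesaro Q t)) atTop (𝓝 (∫ η, f η ∂μ)) := by
  have := borelSpace_of_finite_of_discrete (E := E)
  rw [Metric.tendsto_atTop]
  intro δ hδ
  obtain ⟨r, e, hdep, happrox⟩ :=
    exists_dependsOn_spaceTimeBall_abs_sub_le f.continuous (by positivity : 0 < δ / 4)
  have hfm : BddMeasurable f := ⟨f.continuous.measurable, ‖f‖, f.norm_coe_le_norm⟩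
  have hgm : BddMeasurable fun η => f (e η) :=
    ⟨measurable_of_dependsOn_finite (finite_spaceTimeBall d r) hdep, ‖f‖,
      fun η => f.norm_coe_le_norm (e η)⟩
  have hclose : ∀ ρ : Measure (Env d E), IsProbabilityMeasure ρ →
      |∫ η, f η ∂ρ - ∫ η, f (e η) ∂ρ| ≤ δ / 4 := by
    intro ρ _
    rw [← integral_sub (hfm.integrable ρ) (hgm.integrable ρ)]
    simpa using norm_integral_le_of_norm_le_const (μ := ρ) (f := fun η => f η - f (e η))
      (ae_of_all _ happrox)
  obtain ⟨T, hT⟩ := Metric.tendsto_atTop.1 (hμ.tendsto_integral_cesaro_of_dependsOn hε hW hP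
    htail hQ hgm hdep) (δ / 4) (by positivity)
  -- Time `0` is excluded because the Cesàro average is then not a probability measure.
  refine ⟨max T 1, fun t ht => ?_⟩
  have h1 := hT t (le_of_max_le_left ht)
  have h2 := hclose (W.cesaro Q t)
    (W.isProbabilityMeasure_cesaro Q (Nat.one_le_iff_ne_zero.1 (le_of_max_le_right ht)))
  have h3 := hclose μ inferInstance
  rw [Real.dist_eq, abs_lt] at h1 ⊢
  rw [abs_le] at h2 h3
  constructor <;> linarith [h1.1, h1.2, h2.1, h2.2, h3.1, h3.2]

end Walk

end RWRE

end
theorem theorem1p1 {d R : ℕ} {E : Type*} [Finite E] [MeasurableSpace E]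
    [MeasurableSingletonClass E] [TopologicalSpace E] [DiscreteTopology E]
    (W : RWRE.Walk d E R) (P : Measure (RWRE.Env d E)) [IsProbabilityMeasure P]
    (hP : RWRE.TranslationInvariant P) (hmix : W.ConeMixing P) :
    ∃ PEP : Measure (RWRE.Env d E), IsProbabilityMeasure PEP ∧ W.IsInvariant PEP ∧
      (∀ B, MeasurableSet[RWRE.coneTail d E R] B → PEP B = P B) ∧
      (W.EllipticInTime → RWRE.ErgodicInTime P →
        W.IsErgodic PEP ∧
        ∀ Q : Measure (RWRE.Env d E), IsProbabilityMeasure Q →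
          (∀ B, MeasurableSet[RWRE.coneTail d E R] B → P B = 0 → Q B = 0) →
          ∀ f : RWRE.Env d E →ᵇ ℝ,
            Tendsto (fun t : ℕ => ∫ η, f η ∂(W.cesaro Q t)) atTop (𝓝 (∫ η, f η ∂PEP))) := by
  obtain ⟨μ, hμ, hinv, htail⟩ := W.exists_isInvariant hP hmix
  refine ⟨μ, hμ, hinv, htail, fun hell herg => ?_⟩
  have : Nonempty (RWRE.Env d E) := nonempty_of_isProbabilityMeasure P
  obtain ⟨ε, hε, hW⟩ := hell.exists_le_weight
  have hμe := hinv.isErgodic hell hε hW hP herg htail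
  exact ⟨hμe, fun Q _ hQ f => hμe.tendsto_integral_cesaro hε hW hP htail hQ f⟩
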